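/- Fix the following setting. There are $n$ players; player $i$ holds $X_i$, where $X_1,\dots,X_n$ are i.i.d. samples from an unknown probability distribution $\mathbf p$ on $[k]\times[k]$, $[k]=\{1,\dots,k\}$. A channel $W$ from $[k]\times[k]$ to the set $\{0,1\}^*$ of finite binary strings is \emph{$\rho$-LDP} if $W(y\mid x')\le e^{\rho}\,W(y\mid x)$ for all $x,x'\in[k]\times[k]$ and $y\in\{0,1\}^*$. In a \emph{private-coin $\rho$-LDP protocol}, player $i$ has private randomness $U_i$, where $U_1,\dots,U_n$ are independent of each other and of the samples; the player selects a $\rho$-LDP channel $W_i$ as a function of $U_i$ and sends to a referee the output $Y_i$ of $W_i$ on $X_i$. In a \emph{public-coin $\rho$-LDP protocol} there is in addition a random variable $V$, independent of all $X_i$ and $U_i$, known to all players and to the referee, and $W_i$ is selected as a function of $(V,U_i)$. The referee applies a randomized map $T$ with values in $\{0,1\}$ to $(Y_1,\dots,Y_n)$ (in the public-coin case, to $(Y_1,\dots,Y_n)$ and $V$). The protocol together with $T$ is a \emph{protocol for $(k,\varepsilon,\delta)$-independence testing} if, for every distribution $\mathbf p$ on $[k]\times[k]$, the output equals $1$ with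 probability greater than $1-\delta$ whenever $\mathbf p$ is the product of its two marginals, and equals $0$ with probability greater than $1-\delta$ whenever $$\inf_{\mathbf q_1,\mathbf q_2} d_{\mathrm{TV}}(\mathbf p,\mathbf q_1\otimes\mathbf q_2)>\varepsilon,$$ the infimum being over all probability distributions $\mathbf q_1,\mathbf q_2$ on $[k]$, with $d_{\mathrm{TV}}(\mathbf p,\mathbf q)=\tfrac12\sum_x|\mathbf p(x)-\mathbf q(x)|$. \textbf{Theorem.} There is an absolute constant $c>0$ such that, for every integer $k\ge 2$, every $\varepsilon\in(0,1/6]$, every $\rho\in(0,1]$ and every $n$: every private-coin $\rho$-LDP protocol for $(k,\varepsilon,1/12)$-independence testing with $n$ players satisfies $$n\ \ge\ c\,\frac{k^{3}}{\varepsilon^{2}\rho^{2}},$$ and every public-coin $\rho$-LDP protocol for $(k,\varepsilon,1/12)$-independence testing with $n$ players satisfies $$n\ \ge\ c\,\frac{k^{2}}{\varepsilon^{2}\rho^{2}}.$$ -/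

import Mathlib

open MeasureTheory

universe u

/-- Messages are finite binary strings. -/
abbrev Message : Type := List Bool

/-- A channel `W` from `X` to binary strings is `ρ`-locally differentially private if
`W(y ∣ x') ≤ e^ρ · W(y ∣ x)` for all inputs `x`, `x'` and all messages `y`. -/
def IsLDP {X : Type} (ρ : ℝ) (W : X → PMF Message) : Prop :=
  ∀ (x x' : X) (y : Message), W x' y ≤ ENNReal.ofReal (Real.exp ρ) * W x y

/-- A `ρ`-LDP private-coin simultaneous-message protocol with `n` players, each holding a sample
in `X`. Player `i` has private randomness `U i` with law `seedLaw i` (the `U i` are independent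
of each other and of the samples), selects the `ρ`-LDP channel `channel i (U i)`, and sends the
output of this channel on the player's sample. -/
structure PrivateCoinProtocol (X : Type) (ρ : ℝ) (n : ℕ) where
  Seed : Fin n → Type u
  [measurableSpaceSeed : ∀ i, MeasurableSpace (Seed i)]
  seedLaw : ∀ i, Measure (Seed i)
  [isProbabilityMeasure_seedLaw : ∀ i, IsProbabilityMeasure (seedLaw i)]
  channel : ∀ i, Seed i → X → PMF Message
  measurable_channel : ∀ (i : Fin n) (x : X) (y : Message),
    Measurable fun s : Seed i => channel i s x y
  isLDP_channel : ∀ (i : Fin n) (s : Seed i), IsLDP ρ (channel i s)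

attribute [instance] PrivateCoinProtocol.measurableSpaceSeed
  PrivateCoinProtocol.isProbabilityMeasure_seedLaw

/-- A `ρ`-LDP public-coin simultaneous-message protocol with `n` players, each holding a sample
in `X`. In addition to the private randomness `U i` there is a public random variable `V` with
law `publicLaw`, jointly independent of the `U i` and of the samples; player `i` selects the
`ρ`-LDP channel `channel i V (U i)`. -/
structure PublicCoinProtocol (X : Type) (ρ : ℝ) (n : ℕ) where
  Seed : Fin n → Type u
  [measurableSpaceSeed : ∀ i, MeasurableSpace (Seed i)]
  seedLaw : ∀ i, Measure (Seed i)
  [isProbabilityMeasure_seedLaw : ∀ i, IsProbabilityMeasure (seedLaw i)]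
  PublicSeed : Type u
  [measurableSpacePublicSeed : MeasurableSpace PublicSeed]
  publicLaw : Measure PublicSeed
  [isProbabilityMeasure_publicLaw : IsProbabilityMeasure publicLaw]
  channel : ∀ i, PublicSeed → Seed i → X → PMF Message
  measurable_channel : ∀ (i : Fin n) (x : X) (y : Message),
    Measurable fun w : PublicSeed × Seed i => channel i w.1 w.2 x y
  isLDP_channel : ∀ (i : Fin n) (r : PublicSeed) (s : Seed i), IsLDP ρ (channel i r s)

attribute [instance] PublicCoinProtocol.measurableSpaceSeed
  PublicCoinProtocol.isProbabilityMeasure_seedLaw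
  PublicCoinProtocol.measurableSpacePublicSeed
  PublicCoinProtocol.isProbabilityMeasure_publicLaw

/-- The probability that the referee outputs `b` when the `n` samples are i.i.d. from `p`, the
private seeds are independent, and the referee applies the randomized map `T` to the messages. -/
noncomputable def PrivateCoinProtocol.outputProb {X : Type} [Fintype X] {ρ : ℝ} {n : ℕ}
    (π : PrivateCoinProtocol.{u} X ρ n) (T : (Fin n → Message) → PMF Bool)
    (p : PMF X) (b : Bool) : ENNReal :=
  ∑ x : Fin n → X, (∏ i, p (x i)) *
    ∫⁻ s : (∀ i, π.Seed i),
      ∑' y : Fin n → Message, (∏ i, π.channel i (s i) (x i) (y i)) * T y b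
      ∂(Measure.pi π.seedLaw)

/-- The randomized decision of the referee in a public-coin protocol. The referee sees the
messages and the public randomness, but not the private randomness. -/
structure PublicCoinProtocol.Referee {X : Type} {ρ : ℝ} {n : ℕ}
    (π : PublicCoinProtocol.{u} X ρ n) where
  decide : π.PublicSeed → (Fin n → Message) → PMF Bool
  measurable_decide : ∀ (y : Fin n → Message) (b : Bool), Measurable fun r => decide r y b

/-- The probability that the referee outputs `b` when the `n` samples are i.i.d. from `p`, and
the public seed and the private seeds are all independent. -/
noncomputable def PublicCoinProtocol.outputProb {X : Type} [Fintype X] {ρ : ℝ} {n : ℕ}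
    (π : PublicCoinProtocol.{u} X ρ n) (T : π.Referee) (p : PMF X) (b : Bool) : ENNReal :=
  ∑ x : Fin n → X, (∏ i, p (x i)) *
    ∫⁻ r : π.PublicSeed, ∫⁻ s : (∀ i, π.Seed i),
      ∑' y : Fin n → Message, (∏ i, π.channel i r (s i) (x i) (y i)) * T.decide r y b
      ∂(Measure.pi π.seedLaw) ∂π.publicLaw

/-- Total variation distance on a finite domain: half of the `ℓ₁` distance. -/
noncomputable def tvDist {X : Type} [Fintype X] (p q : PMF X) : ℝ :=
  (1 / 2) * ∑ x, |(p x).toReal - (q x).toReal|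

/-- The product distribution `p₁ ⊗ p₂`. -/
noncomputable def prodDist {A B : Type} (p₁ : PMF A) (p₂ : PMF B) : PMF (A × B) :=
  p₁.bind fun a => p₂.map fun b => (a, b)

theorem prodDist_apply {A B : Type} (p₁ : PMF A) (p₂ : PMF B) (z : A × B) :
    prodDist p₁ p₂ z = p₁ z.1 * p₂ z.2 := by
  classical
  obtain ⟨a, b⟩ := z
  simp only [prodDist, PMF.bind_apply, PMF.map_apply, Prod.mk.injEq]
  rw [tsum_eq_single a]
  · rw [tsum_eq_single b]
    · simp
    · intro b' hb'
      simp [hb'.symm]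
  · intro a' ha'
    simp [ha'.symm]

/-- `p` is the product of its two marginals. -/
def IsIndependent {k : ℕ} (p : PMF (Fin k × Fin k)) : Prop :=
  p = prodDist (p.map Prod.fst) (p.map Prod.snd)

/-- The total variation distance from `p` to the set of all product distributions. -/
noncomputable def distToProducts {k : ℕ} (p : PMF (Fin k × Fin k)) : ℝ :=
  ⨅ q : PMF (Fin k) × PMF (Fin k), tvDist p (prodDist q.1 q.2)

/-- `outputProb p b`, the probability that the output is `b` (`true` for accept, `false` for
reject) when the samples come from `p`, solves the `(k, ε, δ)`-independence testing problem. -/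
def SolvesIndependenceTesting (k : ℕ) (ε δ : ℝ)
    (outputProb : PMF (Fin k × Fin k) → Bool → ENNReal) : Prop :=
  ∀ p : PMF (Fin k × Fin k),
    (IsIndependent p → ENNReal.ofReal (1 - δ) < outputProb p true) ∧
    (ε < distToProducts p → ENNReal.ofReal (1 - δ) < outputProb p false)

/-! The argument is a second-moment (Ingster) lower bound. The null hypothesis is the uniform law on
an embedded `[2h] × [2h]`, `h = ⌊k/2⌋`. The alternatives perturb each of the `m = h²` blocks of size
`2 × 2` by a checkerboard of relative size `γ = 5ε` and sign `z b`. A `2 × 2` product matrix has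
determinant zero, so it cannot follow a checkerboard, and every alternative is at distance at least
`γ/4 > ε` from all products (`two_mul_abs_le_of_rank_one`, `le_distToProducts_blockPMF`).

Private seeds are averaged into the channels, which keeps them `ρ`-LDP. Each block then changes a
message law by a relative amount at most `α = 2γρ/h²`. Tensorization over the players bounds the
`χ²` inner product of the alternatives `z`, `z'` by `exp (zᵀ M z')`, where `M` is positive
semidefinite with diagonal at most `κ = n α²`. If this exponential has bounded mean under a prior on
`z`, up to truncation, the referee cannot separate the mixture from the null (`mixture_le`).

Write `M = κ ⟨v_i, v_j⟩` with `‖v_i‖ ≤ 1`, so that `zᵀ M z' = κ ⟨S_z, S_z'⟩` for the signed sums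
`S_z = ∑ z_i v_i`. With uniform signs, `S_z` may have variance of order `m` in one direction, as
when all `v_i` coincide, and `κ m ≲ 1` is needed. This prior does not depend on the channels, so the
bound can be integrated over a public seed: `n ≳ k²/(ε²ρ²)`. With private coins `M` is deterministic
and the prior may depend on it. A Gram–Schmidt walk from discrepancy theory yields signs for which
`S_z` is subgaussian with an absolute constant in every direction (`exists_subgaussian_signs`). Then
`‖S_z‖² ≲ m` with high probability and the exponent has variance of order `κ² m`. The weaker
condition `κ √m ≲ 1` suffices, which gives the extra factor `k`. -/

/-! ### Subgaussian signed sums by a Gram–Schmidt walk. -/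

section RandomSigns

open scoped RealInnerProductSpace

/-- The real sign `±1` of a Boolean. -/
def boolSign (b : Bool) : ℝ := if b then 1 else -1

theorem boolSign_sq (b : Bool) : boolSign b * boolSign b = 1 := by
  cases b <;> norm_num [boolSign]

theorem abs_boolSign (b : Bool) : |boolSign b| = 1 := by
  cases b <;> norm_num [boolSign]

variable {ι : Type} [Fintype ι] [DecidableEq ι]
variable {E : Type} [NormedAddCommGroup E] [InnerProductSpace ℝ E]

-- Only the component of `θ` in `V ⊖ U` meets `e`. By Pythagoras its squared norm is the difference
-- of the two projections, and Cauchy–Schwarz finishes.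
variable [FiniteDimensional ℝ E] in
theorem sq_inner_le_of_orthogonal {U V : Submodule ℝ E} (hUV : U ≤ V) (θ : E) {e : E}
    (heV : e ∈ V) (heU : e ∈ Uᗮ) :
    ⟪θ, e⟫ ^ 2 ≤ (‖V.starProjection θ‖ ^ 2 - ‖U.starProjection θ‖ ^ 2) * ‖e‖ ^ 2 := by
  have h1 : ⟪V.starProjection θ - U.starProjection θ, e⟫ = ⟪θ, e⟫ := by
    rw [inner_sub_left, Submodule.inner_right_of_mem_orthogonal
      (Submodule.starProjection_apply_mem U θ) heU, sub_zero,
      Submodule.inner_starProjection_left_eq_right,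
      Submodule.starProjection_eq_self_iff.2 heV]
  have h2 : ‖V.starProjection θ‖ ^ 2 - ‖U.starProjection θ‖ ^ 2
      = ‖V.starProjection θ - U.starProjection θ‖ ^ 2 := by
    have h3 : ⟪V.starProjection θ, U.starProjection θ⟫ = ‖U.starProjection θ‖ ^ 2 := by
      rw [Submodule.inner_starProjection_left_eq_right,
        Submodule.starProjection_eq_self_iff.2 (hUV (Submodule.starProjection_apply_mem U θ)),
        ← Submodule.starProjection_eq_self_iff.2 (Submodule.starProjection_apply_mem U θ),
        ← Submodule.inner_starProjection_left_eq_right,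
        Submodule.starProjection_eq_self_iff.2 (Submodule.starProjection_apply_mem U θ),
        real_inner_self_eq_norm_sq]
    rw [norm_sub_sq_real, h3]; ring
  rw [h2, ← h1, ← mul_pow]
  exact sq_le_sq' (by linarith [neg_le_of_abs_le (abs_real_inner_le_norm
    (V.starProjection θ - U.starProjection θ) e)]) (real_inner_le_norm _ _)

variable [FiniteDimensional ℝ E] in
theorem norm_starProjection_le_of_le {U V : Submodule ℝ E} (hUV : U ≤ V) (θ : E) :
    ‖U.starProjection θ‖ ^ 2 ≤ ‖V.starProjection θ‖ ^ 2 := by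
  have h : U.starProjection (V.starProjection θ) = U.starProjection θ := by
    rw [← ContinuousLinearMap.comp_apply, Submodule.starProjection_comp_starProjection_of_le hUV]
  rw [← h]
  gcongr
  exact Submodule.norm_starProjection_apply_le _ _

variable [FiniteDimensional ℝ E] in
/-- The potential of the random walk while the coordinate with vector `v` is the pivot and the
vectors of the other unfrozen coordinates span `U`. -/
noncomputable def walkPotential (U : Submodule ℝ E) (v θ : E) (g : ℝ) : ℝ :=
  ‖U.starProjection θ‖ ^ 2 +
    ⟪θ, v - U.starProjection v⟫ ^ 2 / (‖v - U.starProjection v‖ ^ 2 + g)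

/-- Cauchy–Schwarz in the form `(a + b)²/(S + β²) ≤ a²/S + b²/β²`, with `D` in place of `b²/β²` so
that `β = 0` is allowed. -/
theorem sq_add_div_le {a b S D β2 : ℝ} (hS : 0 < S) (hβ : 0 ≤ β2)
    (hD : 0 ≤ D) (hb : b ^ 2 ≤ D * β2) : (a + b) ^ 2 / (S + β2) ≤ a ^ 2 / S + D := by
  have h : 2 * (a * b * S) ≤ a ^ 2 * β2 + S ^ 2 * D := by
    have h1 : (2 * (a * b * S)) ^ 2 ≤ (a ^ 2 * β2 + S ^ 2 * D) ^ 2 := by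
      have : a ^ 2 * S ^ 2 * b ^ 2 ≤ a ^ 2 * S ^ 2 * (D * β2) := by gcongr
      nlinarith [sq_nonneg (a ^ 2 * β2 - S ^ 2 * D)]
    exact le_trans (le_abs_self _) (abs_le_of_sq_le_sq h1 (by positivity))
  rw [div_add' _ _ _ hS.ne', div_le_div_iff₀ (by positivity) hS]
  nlinarith

-- Freezing a non-pivot coordinate shrinks the span. The residual of `v` then gains an orthogonal
-- part `e`, and the loss in `‖P θ‖²` pays for the extra term by `sq_add_div_le`.
variable [FiniteDimensional ℝ E] in
theorem walkPotential_mono {U V : Submodule ℝ E} (hUV : U ≤ V) (v θ : E) {g : ℝ} (hg : 0 < g) :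
    walkPotential U v θ g ≤ walkPotential V v θ g := by
  set e := V.starProjection v - U.starProjection v with he
  have heV : e ∈ V := V.sub_mem (V.starProjection_apply_mem v) (hUV (U.starProjection_apply_mem v))
  have hw : v - U.starProjection v = (v - V.starProjection v) + e := by simp [he]
  have hwV : v - V.starProjection v ∈ Vᗮ := Submodule.sub_starProjection_mem_orthogonal v
  have heU : e ∈ Uᗮ := by
    have : e = (v - U.starProjection v) - (v - V.starProjection v) := by simp [he]
    rw [this]
    exact Uᗮ.sub_mem (Submodule.sub_starProjection_mem_orthogonal v)
      (Submodule.orthogonal_le hUV hwV)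
  have hn : ‖v - U.starProjection v‖ ^ 2 = ‖v - V.starProjection v‖ ^ 2 + ‖e‖ ^ 2 := by
    rw [hw, norm_add_sq_real, Submodule.inner_left_of_mem_orthogonal heV hwV]; ring
  have hb := sq_inner_le_of_orthogonal hUV θ heV heU
  have hD := norm_starProjection_le_of_le hUV θ
  unfold walkPotential
  rw [hn, hw, inner_add_right]
  have := sq_add_div_le (a := ⟪θ, v - V.starProjection v⟫)
    (S := ‖v - V.starProjection v‖ ^ 2 + g) (by positivity) (sq_nonneg ‖e‖)
    (sub_nonneg.2 hD) hb
  rw [show ‖v - V.starProjection v‖ ^ 2 + ‖e‖ ^ 2 + g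
    = ‖v - V.starProjection v‖ ^ 2 + g + ‖e‖ ^ 2 by ring]
  linarith

-- Used when a new pivot is chosen. With `g = 0` the second term would be the squared component of
-- `θ` along the residual of `v`; `g > 0` only decreases it.
variable [FiniteDimensional ℝ E] in
theorem walkPotential_le {U V : Submodule ℝ E} (hUV : U ≤ V) {v : E} (hv : v ∈ V) (θ : E)
    {g : ℝ} (hg : 0 < g) : walkPotential U v θ g ≤ ‖V.starProjection θ‖ ^ 2 := by
  have hb := sq_inner_le_of_orthogonal hUV θ
    (V.sub_mem hv (hUV (U.starProjection_apply_mem v)))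
    (Submodule.sub_starProjection_mem_orthogonal v)
  have hD := norm_starProjection_le_of_le hUV θ
  have : ⟪θ, v - U.starProjection v⟫ ^ 2 / (‖v - U.starProjection v‖ ^ 2 + g)
      ≤ ‖V.starProjection θ‖ ^ 2 - ‖U.starProjection θ‖ ^ 2 := by
    rw [div_le_iff₀ (by positivity)]
    nlinarith
  unfold walkPotential
  linarith

/-- On `[-1, 1]` the function `y ↦ 1 / (s + 8 + y²)` is strongly concave, so the potential falls
quadratically below its tangent at `x`. That gain, `800 a² r² / 200 = 4 a² r²`, absorbs the
quadratic error `u² ≤ (2ar)²` in `exp u ≤ 1 + u + u²`. What remains is linear in `y - x` and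
averages to zero over a centred step. The condition `|a| ≤ 1/25` makes the potential term, at most
`(800/32) a² |r|`, no larger than `|a| |r|`. -/
theorem exp_step_le {a s x y : ℝ} (ha : |a| ≤ 1 / 25) (hs : 0 ≤ s) (hs1 : s ≤ 1)
    (hx : |x| ≤ 1) (hy : |y| ≤ 1) :
    Real.exp (a * (y - x) + 800 * (a ^ 2 / (s + (8 + y ^ 2)))) ≤
      Real.exp (800 * (a ^ 2 / (s + (8 + x ^ 2)))) *
        (1 + (a - 1600 * a ^ 2 * x / (s + (8 + x ^ 2)) ^ 2) * (y - x)) := by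
  rw [abs_le] at ha hx hy
  set P := s + (8 + x ^ 2) with hP
  set R := s + (8 + y ^ 2) with hR
  have hx2 : x ^ 2 ≤ 1 := by nlinarith
  have hy2 : y ^ 2 ≤ 1 := by nlinarith
  have hP8 : 8 ≤ P := by nlinarith
  have hR8 : 8 ≤ R := by nlinarith
  have hP10 : P ≤ 10 := by nlinarith
  have hP0 : 0 < P := by linarith
  have hR0 : 0 < R := by linarith
  have ha2 : a ^ 2 ≤ 1 / 625 := by nlinarith
  set r := y - x with hr
  have hdiff : 1 / R - 1 / P = -(2 * x * r) / P ^ 2 - r ^ 2 / P ^ 2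
      + (x + y) ^ 2 * r ^ 2 / (P ^ 2 * R) := by
    field_simp
    rw [hP, hR, hr]
    ring
  have hub : 1 / R - 1 / P ≤ -(2 * x * r) / P ^ 2 - r ^ 2 / 200 := by
    have h1 : (x + y) ^ 2 * r ^ 2 / (P ^ 2 * R) ≤ r ^ 2 / P ^ 2 / 2 := by
      rw [div_div, div_le_div_iff₀ (by positivity) (by positivity)]
      have : (x + y) ^ 2 ≤ 4 := by nlinarith
      have h0 : 0 ≤ r ^ 2 * P ^ 2 := by positivity
      nlinarith [mul_le_mul_of_nonneg_left this h0, mul_le_mul_of_nonneg_left hR8 h0]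
    have h2 : r ^ 2 / 100 ≤ r ^ 2 / P ^ 2 := by
      apply div_le_div_of_nonneg_left (sq_nonneg _) (by positivity)
      nlinarith
    rw [hdiff]
    linarith
  have habs : |1 / R - 1 / P| ≤ |r| / 32 := by
    have : 1 / R - 1 / P = -(x + y) * r / (P * R) := by
      field_simp
      rw [hP, hR, hr]
      ring
    rw [this, abs_div, abs_mul, abs_neg, abs_of_pos (mul_pos hP0 hR0),
      div_le_div_iff₀ (by positivity) (by norm_num)]
    have h1 : |x + y| ≤ 2 := by rw [abs_le]; constructor <;> linarith
    have h2 : 64 ≤ P * R := by nlinarith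
    nlinarith [mul_le_mul_of_nonneg_left h1 (abs_nonneg r),
      mul_le_mul_of_nonneg_left h2 (abs_nonneg r)]
  set u := a * r + 800 * a ^ 2 * (1 / R - 1 / P) with hu
  have hua : |u| ≤ 2 * |a| * |r| := by
    have h1 : |a| ≤ 1 / 25 := abs_le.2 ha
    calc |u| ≤ |a * r| + |800 * a ^ 2 * (1 / R - 1 / P)| := abs_add_le _ _
      _ = |a| * |r| + 800 * |a| ^ 2 * |1 / R - 1 / P| := by
        rw [abs_mul, abs_mul, abs_mul, abs_pow]; norm_num
      _ ≤ |a| * |r| + 800 * |a| ^ 2 * (|r| / 32) := by gcongr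
      _ ≤ 2 * |a| * |r| := by
        have : |a| * (|a| * |r|) ≤ 1 / 25 * (|a| * |r|) := by gcongr
        nlinarith
  have hr2 : |r| ≤ 2 := by rw [hr, abs_le]; constructor <;> linarith
  have hu1 : |u| ≤ 1 := by
    have h1 : |a| ≤ 1 / 25 := abs_le.2 ha
    have : |a| * |r| ≤ 1 / 25 * 2 := by gcongr
    nlinarith
  have hu2 : u ^ 2 ≤ 4 * a ^ 2 * r ^ 2 := by
    calc u ^ 2 = |u| ^ 2 := (sq_abs u).symm
      _ ≤ (2 * |a| * |r|) ^ 2 := by gcongr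
      _ = 4 * a ^ 2 * r ^ 2 := by rw [mul_pow, mul_pow, sq_abs, sq_abs]; norm_num
  have hexp : Real.exp u ≤ 1 + u + u ^ 2 := by
    have := (abs_le.1 (Real.abs_exp_sub_one_sub_id_le hu1)).2
    linarith
  have hfin : Real.exp u ≤ 1 + (a - 1600 * a ^ 2 * x / P ^ 2) * r := by
    have h1 : 800 * a ^ 2 * (1 / R - 1 / P) ≤
        800 * a ^ 2 * (-(2 * x * r) / P ^ 2 - r ^ 2 / 200) := by gcongr
    have h2 : 1600 * a ^ 2 * x / P ^ 2 * r = 800 * a ^ 2 * ((2 * x * r) / P ^ 2) := by ring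
    rw [neg_div] at h1
    rw [sub_mul, h2]
    linarith
  calc Real.exp (a * r + 800 * (a ^ 2 / R))
      = Real.exp (800 * (a ^ 2 / P)) * Real.exp u := by
        rw [← Real.exp_add]; congr 1; rw [hu]; ring
    _ ≤ _ := mul_le_mul_of_nonneg_left hfin (Real.exp_pos _).le

/-- Existence of random signs with mean-`x` signed sums whose exponential moments are bounded
through `F`. -/
def HasBalancedSigns (v : ι → E) (x : ι → ℝ) (F : E → ℝ) : Prop :=
  ∃ μ : (ι → Bool) → ℝ, (∀ z, 0 ≤ μ z) ∧ ∑ z, μ z = 1 ∧ ∀ θ : E, ‖θ‖ ≤ 1 / 25 →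
    ∑ z, μ z * Real.exp ⟪θ, ∑ i, (boolSign (z i) - x i) • v i⟫ ≤ Real.exp (800 * F θ)

theorem HasBalancedSigns.mono {v : ι → E} {x : ι → ℝ} {F G : E → ℝ}
    (h : HasBalancedSigns v x F) (hFG : ∀ θ, F θ ≤ G θ) : HasBalancedSigns v x G := by
  obtain ⟨μ, h0, h1, h2⟩ := h
  refine ⟨μ, h0, h1, fun θ hθ => (h2 θ hθ).trans ?_⟩
  gcongr
  exact hFG θ

theorem HasBalancedSigns.of_abs_eq_one {v : ι → E} {x : ι → ℝ} (hx : ∀ i, |x i| = 1)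
    {F : E → ℝ} (hF : ∀ θ, 0 ≤ F θ) : HasBalancedSigns v x F := by
  classical
  let z₀ : ι → Bool := fun i => decide (x i = 1)
  have hz : ∀ i, boolSign (z₀ i) = x i := by
    intro i
    rcases (abs_eq zero_le_one).1 (hx i) with h | h <;> simp [boolSign, z₀, h]
    norm_num
  refine ⟨fun z => if z = z₀ then 1 else 0, fun z => by positivity, by simp, fun θ _ => ?_⟩
  simp only [ite_mul, one_mul, zero_mul, Finset.sum_ite_eq', Finset.mem_univ, if_true, hz,
    sub_self, zero_smul, Finset.sum_const_zero, inner_zero_right, Real.exp_zero]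
  exact Real.one_le_exp (by have := hF θ; positivity)

/-- One step of the walk along the direction `d`, forwards by `α` or backwards by `β`. -/
theorem HasBalancedSigns.of_step {v : ι → E} {x d : ι → ℝ} {w : E}
    (hw : ∑ i, d i • v i = w) (hwn : ‖w‖ ≤ 1) {p : ι}
    {α β : ℝ} (hα : 0 < α) (hβ : 0 < β) (hx : |x p| ≤ 1) (hxα : |x p + α| ≤ 1)
    (hxβ : |x p - β| ≤ 1) {N : E → ℝ}
    (h₁ : HasBalancedSigns v (x + α • d)
      fun θ => N θ + ⟪θ, w⟫ ^ 2 / (‖w‖ ^ 2 + (8 + (x p + α) ^ 2)))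
    (h₂ : HasBalancedSigns v (x - β • d)
      fun θ => N θ + ⟪θ, w⟫ ^ 2 / (‖w‖ ^ 2 + (8 + (x p - β) ^ 2))) :
    HasBalancedSigns v x fun θ => N θ + ⟪θ, w⟫ ^ 2 / (‖w‖ ^ 2 + (8 + x p ^ 2)) := by
  obtain ⟨μ, hμ0, hμ1, hμ⟩ := h₁
  obtain ⟨ν, hν0, hν1, hν⟩ := h₂
  have hαβ : 0 < α + β := by positivity
  -- These weights give the two-point step mean zero, so the linear terms of `exp_step_le`, which
  -- share the slope `ℓ`, cancel.
  refine ⟨fun z => β / (α + β) * μ z + α / (α + β) * ν z,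
    fun z => add_nonneg (mul_nonneg (by positivity) (hμ0 z)) (mul_nonneg (by positivity) (hν0 z)),
    ?_, fun θ hθ => ?_⟩
  · rw [Finset.sum_add_distrib, ← Finset.mul_sum, ← Finset.mul_sum, hμ1, hν1]
    field_simp
    ring
  have hμ' := hμ θ hθ
  have hν' := hν θ hθ
  beta_reduce at hμ' hν'
  set a := ⟪θ, w⟫ with ha
  have ha1 : |a| ≤ 1 / 25 := by
    calc |a| ≤ ‖θ‖ * ‖w‖ := abs_real_inner_le_norm _ _
      _ ≤ 1 / 25 * 1 := by gcongr
      _ = 1 / 25 := by norm_num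
  have hshift : ∀ (t : ℝ) (z : ι → Bool), ⟪θ, ∑ i, (boolSign (z i) - x i) • v i⟫ =
      a * t + ⟪θ, ∑ i, (boolSign (z i) - (x + t • d) i) • v i⟫ := by
    intro t z
    rw [ha, ← hw, mul_comm, ← inner_smul_right, ← inner_add_right, Finset.smul_sum,
      ← Finset.sum_add_distrib]
    congr 1
    refine Finset.sum_congr rfl fun i _ => ?_
    simp only [Pi.add_apply, Pi.smul_apply, smul_eq_mul, smul_smul, ← add_smul]
    congr 1
    ring
  have e₁ : ∑ z, μ z * Real.exp ⟪θ, ∑ i, (boolSign (z i) - x i) • v i⟫ ≤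
      Real.exp (800 * N θ) *
        Real.exp (a * α + 800 * (a ^ 2 / (‖w‖ ^ 2 + (8 + (x p + α) ^ 2)))) := by
    simp only [hshift α, Real.exp_add (a * α)]
    calc _ = Real.exp (a * α) * ∑ z, μ z *
          Real.exp ⟪θ, ∑ i, (boolSign (z i) - (x + α • d) i) • v i⟫ := by
          rw [Finset.mul_sum]; exact Finset.sum_congr rfl fun z _ => by ring
      _ ≤ _ := mul_le_mul_of_nonneg_left hμ' (Real.exp_pos _).le
      _ = _ := by rw [mul_add, Real.exp_add]; ring
  have e₂ : ∑ z, ν z * Real.exp ⟪θ, ∑ i, (boolSign (z i) - x i) • v i⟫ ≤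
      Real.exp (800 * N θ) *
        Real.exp (a * (-β) + 800 * (a ^ 2 / (‖w‖ ^ 2 + (8 + (x p - β) ^ 2)))) := by
    simp only [hshift (-β), Real.exp_add (a * (-β)), neg_smul, ← sub_eq_add_neg]
    calc _ = Real.exp (a * (-β)) * ∑ z, ν z *
          Real.exp ⟪θ, ∑ i, (boolSign (z i) - (x - β • d) i) • v i⟫ := by
          rw [Finset.mul_sum]; exact Finset.sum_congr rfl fun z _ => by ring
      _ ≤ _ := mul_le_mul_of_nonneg_left hν' (Real.exp_pos _).le
      _ = _ := by rw [mul_add, Real.exp_add]; ring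
  have hw2 : ‖w‖ ^ 2 ≤ 1 := by nlinarith [norm_nonneg w]
  have s₁ := exp_step_le ha1 (sq_nonneg ‖w‖) hw2 hx hxα
  have s₂ := exp_step_le ha1 (sq_nonneg ‖w‖) hw2 hx hxβ
  rw [add_sub_cancel_left] at s₁
  rw [sub_sub_cancel_left] at s₂
  set ℓ := a - 1600 * a ^ 2 * x p / (‖w‖ ^ 2 + (8 + x p ^ 2)) ^ 2
  set Z := Real.exp (800 * (a ^ 2 / (‖w‖ ^ 2 + (8 + x p ^ 2))))
  calc ∑ z, (β / (α + β) * μ z + α / (α + β) * ν z) *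
        Real.exp ⟪θ, ∑ i, (boolSign (z i) - x i) • v i⟫
      = β / (α + β) * ∑ z, μ z * Real.exp ⟪θ, ∑ i, (boolSign (z i) - x i) • v i⟫ +
        α / (α + β) * ∑ z, ν z * Real.exp ⟪θ, ∑ i, (boolSign (z i) - x i) • v i⟫ := by
        rw [Finset.mul_sum, Finset.mul_sum, ← Finset.sum_add_distrib]
        exact Finset.sum_congr rfl fun z _ => by ring
    _ ≤ β / (α + β) * (Real.exp (800 * N θ) * (Z * (1 + ℓ * α))) +
        α / (α + β) * (Real.exp (800 * N θ) * (Z * (1 + ℓ * (-β)))) := by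
        gcongr
        · exact e₁.trans (by gcongr)
        · exact e₂.trans (by gcongr)
    _ = Real.exp (800 * N θ) * Z := by field_simp; ring
    _ = _ := by rw [mul_add, Real.exp_add]

/-- The coordinates of `x` in the open interval `(-1, 1)`. -/
noncomputable def aliveCoords (x : ι → ℝ) : Finset ι := {i | |x i| < 1}

/-- Move along `d` until the first live coordinate reaches `±1`. For a live `i` with `d i ≠ 0`, `τ
i` is its hitting time, and the minimiser freezes. -/
theorem exists_freezing_step {x d : ι → ℝ} (hx : ∀ i, |x i| ≤ 1) {p : ι}
    (hp : p ∈ aliveCoords x) (hdp : d p ≠ 0) (hd : ∀ i ∉ aliveCoords x, d i = 0) :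
    ∃ t : ℝ, 0 < t ∧ (∀ i, |(x + t • d) i| ≤ 1) ∧ aliveCoords (x + t • d) ⊂ aliveCoords x := by
  classical
  set A := (aliveCoords x).filter fun i => d i ≠ 0
  have hA : A.Nonempty := ⟨p, by simp [A, hp, hdp]⟩
  let τ : ι → ℝ := fun i => (1 - SignType.sign (d i) * x i) / |d i|
  obtain ⟨j, hj, hmin⟩ := A.exists_min_image τ hA
  have hjA : |x j| < 1 ∧ d j ≠ 0 := by simpa [A, aliveCoords] using hj
  have hτpos : 0 < τ j := by
    apply div_pos _ (abs_pos.2 hjA.2)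
    have := abs_lt.1 hjA.1
    rcases lt_or_gt_of_ne hjA.2 with h | h <;> simp [h] <;> linarith
  have hcube : ∀ i, |x i + τ j * d i| ≤ 1 := by
    intro i
    by_cases hi : i ∈ A
    · have h1 := hmin i hi
      have hi' : |x i| < 1 ∧ d i ≠ 0 := by simpa [A, aliveCoords] using hi
      have h2 := (le_div_iff₀ (abs_pos.2 hi'.2)).1 h1
      have := abs_lt.1 hi'.1
      rcases lt_or_gt_of_ne hi'.2 with h | h
      · simp [h, abs_of_neg h] at h2
        rw [abs_le]; constructor <;> nlinarith
      · simp [h, abs_of_pos h] at h2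
        rw [abs_le]; constructor <;> nlinarith
    · have : d i = 0 := by
        by_cases h : i ∈ aliveCoords x
        · by_contra h'
          exact hi (by simp [A, h, h'])
        · exact hd i h
      simpa [this] using hx i
  refine ⟨τ j, hτpos, fun i => by simpa using hcube i, ?_⟩
  rw [Finset.ssubset_iff_of_subset]
  · refine ⟨j, by simp [aliveCoords, hjA.1], ?_⟩
    have : |x j + τ j * d j| = 1 := by
      have h2 : τ j * |d j| = 1 - SignType.sign (d j) * x j :=
        div_mul_cancel₀ _ (abs_pos.2 hjA.2).ne'
      rcases lt_or_gt_of_ne hjA.2 with h | h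
      · simp [h, abs_of_neg h] at h2
        rw [show x j + τ j * d j = -1 by linarith]; norm_num
      · simp [h, abs_of_pos h] at h2
        rw [show x j + τ j * d j = 1 by linarith]; norm_num
    simp [aliveCoords, this]
  · intro i hi
    by_contra h
    have : d i = 0 := hd i h
    simp [aliveCoords, this] at hi h
    linarith

-- The walk moves the pivot at unit speed while the other live coordinates cancel the projection of
-- `v p` on their span, so the signed sum moves along the Gram–Schmidt residual only.
variable [FiniteDimensional ℝ E] in
theorem exists_direction (v : ι → E) (A : Finset ι) {p : ι} (hp : p ∉ A) :
    ∃ d : ι → ℝ, d p = 1 ∧ (∀ i, i ∉ insert p A → d i = 0) ∧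
      ∑ i, d i • v i = v p - (Submodule.span ℝ (v '' A)).starProjection (v p) := by
  obtain ⟨c, hc⟩ := (Submodule.mem_span_image_finset_iff_exists_fun' ℝ).1
    ((Submodule.span ℝ (v '' A)).starProjection_apply_mem (v p))
  refine ⟨fun i => if i = p then 1 else if i ∈ A then -c i else 0, by simp, ?_, ?_⟩
  · intro i hi
    simp only [Finset.mem_insert, not_or] at hi
    simp [hi.1, hi.2]
  · rw [← hc]
    have : ∀ i, (if i = p then (1 : ℝ) else if i ∈ A then -c i else 0) • v i
        = (if i = p then v i else 0) - (if i ∈ A then c i • v i else 0) := by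
      intro i
      by_cases h : i = p
      · subst h; simp [hp]
      · by_cases h' : i ∈ A <;> simp [h, h']
    simp [this, Finset.sum_sub_distrib]

-- Induction on the number of live coordinates, since each step freezes one. Two bounds are carried
-- together: one with a pivot already chosen, which must be kept while it lives, and one with the
-- choice still free.
variable [FiniteDimensional ℝ E] in
theorem HasBalancedSigns.walk {v : ι → E} (hv : ∀ i, ‖v i‖ ≤ 1) :
    ∀ (n : ℕ) (x : ι → ℝ), (∀ i, |x i| ≤ 1) → (aliveCoords x).card ≤ n →
      (∀ p ∈ aliveCoords x, HasBalancedSigns v x fun θ =>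
        walkPotential (Submodule.span ℝ (v '' ((aliveCoords x).erase p))) (v p) θ
          (8 + x p ^ 2)) ∧
      HasBalancedSigns v x fun θ =>
        ‖(Submodule.span ℝ (v '' (aliveCoords x))).starProjection θ‖ ^ 2 := by
  intro n
  induction n with
  | zero =>
    intro x hx hcard
    have h0 : aliveCoords x = ∅ := by simpa using hcard
    refine ⟨fun p hp => by simp [h0] at hp, .of_abs_eq_one (fun i => ?_) fun θ => by positivity⟩
    have : i ∉ aliveCoords x := by simp [h0]
    simp only [aliveCoords, Finset.mem_filter, Finset.mem_univ, true_and, not_lt] at this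
    exact le_antisymm (hx i) this
  | succ n ih =>
    intro x hx hcard
    have main : ∀ p ∈ aliveCoords x, HasBalancedSigns v x fun θ =>
        walkPotential (Submodule.span ℝ (v '' ((aliveCoords x).erase p))) (v p) θ
          (8 + x p ^ 2) := by
      intro p hp
      set U := Submodule.span ℝ (v '' ((aliveCoords x).erase p)) with hU
      obtain ⟨d, hdp, hd, hdw⟩ := exists_direction v ((aliveCoords x).erase p)
        (Finset.notMem_erase p _)
      rw [Finset.insert_erase hp] at hd
      have next : ∀ y : ι → ℝ, (∀ i, |y i| ≤ 1) → aliveCoords y ⊂ aliveCoords x →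
          HasBalancedSigns v y fun θ => walkPotential U (v p) θ (8 + y p ^ 2) := by
        intro y hy hyx
        obtain ⟨h1, h2⟩ := ih y hy (by have := Finset.card_lt_card hyx; omega)
        -- A live pivot is kept and only the span shrinks. If the pivot froze, its term in the
        -- potential is dropped and the next stage starts without one.
        by_cases hpy : p ∈ aliveCoords y
        · refine (h1 p hpy).mono fun θ => walkPotential_mono (Submodule.span_mono ?_) _ _
            (by positivity)
          exact Set.image_mono (by exact_mod_cast Finset.erase_subset_erase p hyx.1)
        · refine h2.mono fun θ => ?_
          have hle : Submodule.span ℝ (v '' (aliveCoords y)) ≤ U := by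
            refine Submodule.span_mono (Set.image_mono ?_)
            intro i hi
            exact Finset.mem_coe.2 (Finset.mem_erase.2 ⟨fun h => hpy (h ▸ hi), hyx.1 hi⟩)
          refine (norm_starProjection_le_of_le hle θ).trans ?_
          unfold walkPotential
          exact le_add_of_nonneg_right (by positivity)
      obtain ⟨α, hα, hαx, hαA⟩ := exists_freezing_step hx hp (by rw [hdp]; exact one_ne_zero) hd
      obtain ⟨β, hβ, hβx, hβA⟩ := exists_freezing_step (d := -d) hx hp
        (by simp [hdp]) (fun i hi => by simp [hd i hi])
      rw [smul_neg, ← sub_eq_add_neg] at hβx hβA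
      have n₁ := next _ hαx hαA
      have n₂ := next _ hβx hβA
      have p₁ := hαx p
      have p₂ := hβx p
      simp only [Pi.add_apply, Pi.sub_apply, Pi.smul_apply, hdp, smul_eq_mul, mul_one]
        at n₁ n₂ p₁ p₂
      have hwn : ‖v p - U.starProjection (v p)‖ ≤ 1 := by
        rw [← Submodule.starProjection_orthogonal_val]
        exact (Submodule.norm_starProjection_apply_le _ _).trans (hv p)
      exact HasBalancedSigns.of_step hdw hwn hα hβ (hx p) p₁ p₂
        (N := fun θ => ‖U.starProjection θ‖ ^ 2) n₁ n₂
    refine ⟨main, ?_⟩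
    rcases (aliveCoords x).eq_empty_or_nonempty with h0 | ⟨p, hp⟩
    · exact (ih x hx (by simp [h0])).2
    · refine (main p hp).mono fun θ => walkPotential_le (Submodule.span_mono ?_)
        (Submodule.subset_span (Set.mem_image_of_mem v (Finset.mem_coe.2 hp))) θ (by positivity)
      exact Set.image_mono (by exact_mod_cast Finset.erase_subset p _)

variable [FiniteDimensional ℝ E] in
/-- Unit-ball vectors have random signs with a subgaussian signed sum (for small test vectors). -/
theorem exists_subgaussian_signs {v : ι → E} (hv : ∀ i, ‖v i‖ ≤ 1) :
    ∃ μ : (ι → Bool) → ℝ, (∀ z, 0 ≤ μ z) ∧ ∑ z, μ z = 1 ∧ ∀ θ : E, ‖θ‖ ≤ 1 / 25 →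
      ∑ z, μ z * Real.exp ⟪θ, ∑ i, boolSign (z i) • v i⟫ ≤ Real.exp (800 * ‖θ‖ ^ 2) := by
  obtain ⟨μ, h0, h1, h2⟩ := ((HasBalancedSigns.walk hv _ 0 (by simp) le_rfl).2).mono
    (G := fun θ => ‖θ‖ ^ 2) fun θ => by gcongr; exact Submodule.norm_starProjection_apply_le _ _
  exact ⟨μ, h0, h1, by simpa using h2⟩

end RandomSigns

/-! ### Sign distributions with a small truncated exponential moment. -/

section Mixtures

open scoped RealInnerProductSpace

variable {ι : Type} [Fintype ι] [DecidableEq ι]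

theorem sum_compl_sublevel_le {α : Type} [Fintype α] {μ f : α → ℝ} (hμ : ∀ z, 0 ≤ μ z)
    (hf : ∀ z, 0 ≤ f z) {C : ℝ} (hC : 0 < C) (h : ∑ z, μ z * f z ≤ C) :
    ∑ z with ¬ f z ≤ 10 * C, μ z ≤ 1 / 10 := by
  have h1 : 10 * C * ∑ z with ¬ f z ≤ 10 * C, μ z ≤ C := by
    calc 10 * C * ∑ z with ¬ f z ≤ 10 * C, μ z
        = ∑ z with ¬ f z ≤ 10 * C, μ z * (10 * C) := by
          rw [Finset.mul_sum]; exact Finset.sum_congr rfl fun _ _ => mul_comm _ _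
      _ ≤ ∑ z with ¬ f z ≤ 10 * C, μ z * f z := by
          refine Finset.sum_le_sum fun z hz => mul_le_mul_of_nonneg_left ?_ (hμ z)
          exact (not_le.1 (Finset.mem_filter.1 hz).2).le
      _ ≤ ∑ z, μ z * f z :=
          Finset.sum_le_sum_of_subset_of_nonneg (Finset.filter_subset _ _)
            fun z _ _ => mul_nonneg (hμ z) (hf z)
      _ ≤ C := h
  nlinarith

theorem sum_sum_le_two {α : Type} [Fintype α] {μ : α → ℝ} (hμ : ∀ z, 0 ≤ μ z)
    (hμ1 : ∑ z, μ z = 1) (G : Finset α) {K : α → α → ℝ} (hK : ∀ z z', 0 ≤ K z z')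
    (h : ∀ z ∈ G, ∑ z', μ z' * K z z' ≤ 2) :
    ∑ z ∈ G, ∑ z' ∈ G, μ z * μ z' * K z z' ≤ 2 := by
  calc ∑ z ∈ G, ∑ z' ∈ G, μ z * μ z' * K z z' ≤ ∑ z ∈ G, μ z * 2 := by
        refine Finset.sum_le_sum fun z hz => ?_
        simp only [mul_assoc, ← Finset.mul_sum]
        refine mul_le_mul_of_nonneg_left ((Finset.sum_le_sum_of_subset_of_nonneg
          (Finset.subset_univ G) fun z' _ _ => mul_nonneg (hμ z') (hK z z')).trans (h z hz)) (hμ z)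
    _ ≤ ∑ z, μ z * 2 := Finset.sum_le_sum_of_subset_of_nonneg (Finset.subset_univ G)
        fun z _ _ => mul_nonneg (hμ z) zero_le_two
    _ = 2 := by rw [← Finset.sum_mul, hμ1, one_mul]

/-- `μ` is a probability vector on sign patterns which, off an event of probability at most
`1 / 10`, has small second exponential moment `E exp (zᵀ M z')`. -/
def IsSpread (μ : (ι → Bool) → ℝ) (M : ι → ι → ℝ) : Prop :=
  (∀ z, 0 ≤ μ z) ∧ ∑ z, μ z = 1 ∧ ∃ G : Finset (ι → Bool),
    ∑ z ∈ Gᶜ, μ z ≤ 1 / 10 ∧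
    ∑ z ∈ G, ∑ z' ∈ G, μ z * μ z' *
      Real.exp (∑ i, ∑ j, boolSign (z i) * boolSign (z' j) * M i j) ≤ 2

/-- The set `G` consists of the `z` whose signed sum has squared norm at most `10 C`; Markov's
inequality bounds its complement. For fixed `z ∈ G` the form `zᵀ M z'` is linear in the signed sum
of `z'`, so `hexp` applies. -/
theorem IsSpread.of_gram {E : Type} [NormedAddCommGroup E] [InnerProductSpace ℝ E]
    {μ : (ι → Bool) → ℝ} (hμ : ∀ z, 0 ≤ μ z) (hμ1 : ∑ z, μ z = 1) {M : ι → ι → ℝ} {v : ι → E}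
    {κ : ℝ} (hM : ∀ i j, M i j = κ * ⟪v i, v j⟫) {C : ℝ} (hC : 0 < C)
    (hsecond : ∑ z, μ z * ‖∑ i, boolSign (z i) • v i‖ ^ 2 ≤ C)
    (hexp : ∀ x : E, ‖x‖ ^ 2 ≤ 10 * C →
      ∑ z, μ z * Real.exp ⟪κ • x, ∑ i, boolSign (z i) • v i⟫ ≤ 2) :
    IsSpread μ M := by
  classical
  refine ⟨hμ, hμ1, ({z | ‖∑ i, boolSign (z i) • v i‖ ^ 2 ≤ 10 * C} : Finset _), ?_, ?_⟩
  · rw [Finset.compl_filter]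
    exact sum_compl_sublevel_le hμ (fun _ => by positivity) hC hsecond
  · have hq : ∀ z z' : ι → Bool, ∑ i, ∑ j, boolSign (z i) * boolSign (z' j) * M i j =
        ⟪κ • ∑ i, boolSign (z i) • v i, ∑ i, boolSign (z' i) • v i⟫ := by
      intro z z'
      rw [real_inner_smul_left, sum_inner, Finset.mul_sum]
      refine Finset.sum_congr rfl fun i _ => ?_
      rw [inner_sum, Finset.mul_sum]
      refine Finset.sum_congr rfl fun j _ => ?_
      rw [hM, real_inner_smul_left, real_inner_smul_right]
      ring
    simp only [hq]
    exact sum_sum_le_two hμ hμ1 _ (fun _ _ => (Real.exp_pos _).le)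
      fun z hz => hexp _ (Finset.mem_filter.1 hz).2

open scoped MatrixOrder in
theorem exists_gram {M : Matrix ι ι ℝ} (hM : M.PosSemidef) {κ : ℝ} (hκ : 0 < κ)
    (hdiag : ∀ i, M i i ≤ κ) :
    ∃ v : ι → EuclideanSpace ℝ ι, (∀ i, ‖v i‖ ≤ 1) ∧ ∀ i j, M i j = κ * ⟪v i, v j⟫ := by
  obtain ⟨A, rfl⟩ := CStarAlgebra.nonneg_iff_eq_star_mul_self.1 (Matrix.nonneg_iff_posSemidef.2 hM)
  have hin : ∀ i j, (star A * A) i j = κ *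
      ⟪(√κ)⁻¹ • WithLp.toLp 2 (A.col i), (√κ)⁻¹ • WithLp.toLp 2 (A.col j)⟫ := by
    intro i j
    rw [real_inner_smul_left, real_inner_smul_right, ← mul_assoc, ← mul_assoc,
      mul_assoc κ, ← mul_inv, Real.mul_self_sqrt hκ.le, mul_inv_cancel₀ hκ.ne', one_mul]
    simp [Matrix.mul_apply, PiLp.inner_apply, mul_comm]
  refine ⟨fun i => (√κ)⁻¹ • WithLp.toLp 2 (A.col i), fun i => ?_, hin⟩
  have h := hdiag i
  rw [hin, real_inner_self_eq_norm_sq] at h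
  have : ‖(√κ)⁻¹ • WithLp.toLp 2 (A.col i)‖ ^ 2 ≤ 1 := by
    by_contra hlt
    nlinarith
  exact (sq_le_one_iff₀ (norm_nonneg _)).1 this

/-- For every positive semidefinite `M` some distribution of signs is spread with respect to
`M`. -/
theorem exists_isSpread {M : Matrix ι ι ℝ} (hM : M.PosSemidef) [Nonempty ι] {κ : ℝ} (hκ : 0 < κ)
    (hdiag : ∀ i, M i i ≤ κ) (hκm : κ ^ 2 * Fintype.card ι ≤ 1 / 20000 ^ 2) :
    ∃ μ, IsSpread μ M := by
  obtain ⟨v, hv, hMv⟩ := exists_gram hM hκ hdiag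
  obtain ⟨μ, hμ, hμ1, hsub⟩ := exists_subgaussian_signs hv
  have hm : (0 : ℝ) < Fintype.card ι := by exact_mod_cast Fintype.card_pos
  refine ⟨μ, .of_gram hμ hμ1 hMv (C := 6300 * Fintype.card ι) (by positivity) ?_ ?_⟩
  -- Test vectors `±e_j/30` have norm below `1/25` and give exponential moments at most `exp
  -- (800/900) ≤ e`. Since `2 + y²/1800 ≤ 2 cosh (y/30)`, the second moment is at most `3600 (e - 1)
  -- < 6300`.
  · have hcoord : ∀ j : ι, ∑ z, μ z * (∑ i, boolSign (z i) • v i) j ^ 2 ≤ 6300 := by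
      intro j
      have hexp : ∀ t : ℝ, t = 1 / 30 ∨ t = -(1 / 30) →
          ∑ z, μ z * Real.exp (t * (∑ i, boolSign (z i) • v i) j) ≤ Real.exp 1 := by
        intro t ht
        have hn : ‖t • EuclideanSpace.single j (1 : ℝ)‖ = 1 / 30 := by
          rw [norm_smul, PiLp.norm_single]
          rcases ht with rfl | rfl <;> norm_num
        have := hsub (t • EuclideanSpace.single j (1 : ℝ)) (by rw [hn]; norm_num)
        rw [hn] at this
        simp only [real_inner_smul_left, EuclideanSpace.inner_single_left, map_one, one_mul] at this
        exact this.trans (Real.exp_le_exp.2 (by norm_num))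
      have h1 := hexp _ (Or.inl rfl)
      have h2 := hexp _ (Or.inr rfl)
      have hpt : ∀ y : ℝ, 2 + y ^ 2 / 1800 ≤ Real.exp (1 / 30 * y) + Real.exp (-(1 / 30) * y) := by
        intro y
        rw [neg_mul]
        rcases le_total 0 y with hy | hy
        · have a := Real.quadratic_le_exp_of_nonneg (show 0 ≤ 1 / 30 * y by positivity)
          have b := Real.add_one_le_exp (-(1 / 30 * y))
          nlinarith
        · have a := Real.quadratic_le_exp_of_nonneg (show 0 ≤ -(1 / 30 * y) by linarith)
          have b := Real.add_one_le_exp (1 / 30 * y)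
          nlinarith
      have hsum : 2 + (∑ z, μ z * (∑ i, boolSign (z i) • v i) j ^ 2) / 1800 ≤
          Real.exp 1 + Real.exp 1 := by
        calc _ = ∑ z, μ z * (2 + (∑ i, boolSign (z i) • v i) j ^ 2 / 1800) := by
              simp only [mul_add, Finset.sum_add_distrib, ← Finset.sum_mul, hμ1, one_mul,
                Finset.sum_div, mul_div_assoc]
          _ ≤ ∑ z, μ z * (Real.exp (1 / 30 * (∑ i, boolSign (z i) • v i) j) +
              Real.exp (-(1 / 30) * (∑ i, boolSign (z i) • v i) j)) :=
              Finset.sum_le_sum fun z _ => mul_le_mul_of_nonneg_left (hpt _) (hμ z)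
          _ ≤ _ := by
              simp only [mul_add, Finset.sum_add_distrib]
              exact add_le_add h1 h2
      have := Real.exp_one_lt_d9
      linarith
    calc ∑ z, μ z * ‖∑ i, boolSign (z i) • v i‖ ^ 2
        = ∑ j, ∑ z, μ z * (∑ i, boolSign (z i) • v i) j ^ 2 := by
          rw [Finset.sum_comm]
          refine Finset.sum_congr rfl fun z _ => ?_
          rw [EuclideanSpace.real_norm_sq_eq, Finset.mul_sum]
      _ ≤ ∑ _j : ι, (6300 : ℝ) := Finset.sum_le_sum fun j _ => hcoord j
      _ = 6300 * Fintype.card ι := by simp [mul_comm]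
  -- Here `‖κ x‖² ≤ 63000 κ² m`. The hypothesis on `κ² m` puts `κ x` in the range of the subgaussian
  -- bound and keeps the exponent below `1/2`.
  · intro x hx
    have hn : ‖κ • x‖ ^ 2 ≤ 63000 / 20000 ^ 2 := by
      rw [norm_smul, mul_pow, Real.norm_eq_abs, sq_abs]
      calc κ ^ 2 * ‖x‖ ^ 2 ≤ κ ^ 2 * (10 * (6300 * Fintype.card ι)) := by gcongr
        _ = 63000 * (κ ^ 2 * Fintype.card ι) := by ring
        _ ≤ 63000 * (1 / 20000 ^ 2) := by gcongr
        _ = _ := by ring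
    have hn1 : ‖κ • x‖ ≤ 1 / 25 := by
      by_contra h
      nlinarith [norm_nonneg (κ • x)]
    refine (hsub _ hn1).trans ?_
    calc Real.exp (800 * ‖κ • x‖ ^ 2) ≤ Real.exp (1 / 2) := by
          apply Real.exp_le_exp.2; linarith
      _ ≤ 2 := by
          have := Real.abs_exp_sub_one_sub_id_le (x := 1 / 2) (by norm_num [abs_of_pos])
          have := (abs_le.1 this).2
          linarith

theorem sum_signs_exp (c : ι → ℝ) :
    ∑ z : ι → Bool, Real.exp (∑ i, boolSign (z i) * c i) = ∏ i, (2 * Real.cosh (c i)) := by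
  have h : ∀ i, 2 * Real.cosh (c i) = ∑ b : Bool, Real.exp (boolSign b * c i) := by
    intro i
    rw [Real.cosh_eq]
    simp [boolSign]
    ring
  simp only [h, Real.exp_sum]
  rw [Finset.prod_univ_sum, Fintype.piFinset_univ]

theorem sum_signs_mul {i j : ι} (hij : i ≠ j) :
    ∑ z : ι → Bool, boolSign (z i) * boolSign (z j) = 0 := by
  refine Finset.sum_involution (fun z _ => Function.update z i (!z i)) ?_ ?_ ?_ ?_
  · intro z _
    rw [Function.update_self, Function.update_of_ne hij.symm]
    cases z i <;> cases z j <;> simp [boolSign]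
  · intro z _ _ h
    have := congrFun h i
    simp at this
  · simp
  · intro z _
    simp

/-- Uniform signs are spread with respect to every positive semidefinite `M` of small trace. -/
theorem isSpread_uniform {M : Matrix ι ι ℝ} (hM : M.PosSemidef) [Nonempty ι] {κ : ℝ} (hκ : 0 < κ)
    (hdiag : ∀ i, M i i ≤ κ) (hκm : κ * Fintype.card ι ≤ 1 / 10) :
    IsSpread (fun _ => ((2 : ℝ) ^ Fintype.card ι)⁻¹) M := by
  obtain ⟨v, hv, hMv⟩ := exists_gram hM hκ hdiag
  have hm : (0 : ℝ) < Fintype.card ι := by exact_mod_cast Fintype.card_pos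
  have hcard : ∑ _z : ι → Bool, ((2 : ℝ) ^ Fintype.card ι)⁻¹ = 1 := by
    simp [Finset.card_univ]
  have hv2 : ∀ i, ‖v i‖ ^ 2 ≤ 1 := fun i => by nlinarith [norm_nonneg (v i), hv i]
  refine .of_gram (fun _ => by positivity) hcard hMv hm ?_ ?_
  · have hz : ∀ z : ι → Bool, ‖∑ i, boolSign (z i) • v i‖ ^ 2 =
        ∑ i, ∑ j, boolSign (z i) * boolSign (z j) * ⟪v i, v j⟫ := by
      intro z
      rw [← real_inner_self_eq_norm_sq, sum_inner]
      refine Finset.sum_congr rfl fun i _ => ?_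
      rw [inner_sum]
      refine Finset.sum_congr rfl fun j _ => ?_
      rw [real_inner_smul_left, real_inner_smul_right]
      ring
    have hij : ∀ i j, ∑ z : ι → Bool, boolSign (z i) * boolSign (z j) * ⟪v i, v j⟫ =
        if i = j then (2 : ℝ) ^ Fintype.card ι * ‖v i‖ ^ 2 else 0 := by
      intro i j
      rw [← Finset.sum_mul]
      split_ifs with h
      · subst h
        rw [real_inner_self_eq_norm_sq]
        simp [boolSign_sq]
      · rw [sum_signs_mul h, zero_mul]
    rw [← Finset.mul_sum]
    simp only [hz]
    rw [Finset.sum_comm]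
    simp_rw [Finset.sum_comm (s := (Finset.univ : Finset (ι → Bool))), hij]
    simp only [Finset.sum_ite_eq, Finset.mem_univ, if_true, ← Finset.mul_sum]
    rw [inv_mul_cancel_left₀ (by positivity)]
    calc ∑ i, ‖v i‖ ^ 2 ≤ ∑ _i : ι, (1 : ℝ) := Finset.sum_le_sum fun i _ => hv2 i
      _ = _ := by simp
  · intro x hx
    have hin : ∀ z : ι → Bool, ⟪κ • x, ∑ i, boolSign (z i) • v i⟫ =
        ∑ i, boolSign (z i) * (κ * ⟪x, v i⟫) := by
      intro z
      rw [inner_sum]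
      refine Finset.sum_congr rfl fun i _ => ?_
      rw [real_inner_smul_left, real_inner_smul_right]
      ring
    simp only [hin]
    rw [← Finset.mul_sum, sum_signs_exp, Finset.prod_mul_distrib, Finset.prod_const,
      Finset.card_univ, inv_mul_cancel_left₀ (by positivity)]
    -- Each coordinate is bounded separately by Cauchy–Schwarz. Summing these bounds is what costs
    -- `(κ m)²` instead of `κ² m`.
    have hc : ∀ i, (κ * ⟪x, v i⟫) ^ 2 ≤ κ ^ 2 * (10 * Fintype.card ι) := by
      intro i
      have h1 : ⟪x, v i⟫ ^ 2 ≤ ‖x‖ ^ 2 * ‖v i‖ ^ 2 := by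
        rw [← mul_pow, ← sq_abs]
        exact pow_le_pow_left₀ (abs_nonneg _) (abs_real_inner_le_norm _ _) 2
      rw [mul_pow]
      have h2 : ‖x‖ ^ 2 * ‖v i‖ ^ 2 ≤ ‖x‖ ^ 2 * 1 := by gcongr; exact hv2 i
      gcongr
      linarith
    calc ∏ i, Real.cosh (κ * ⟪x, v i⟫) ≤ ∏ i, Real.exp ((κ * ⟪x, v i⟫) ^ 2 / 2) :=
          Finset.prod_le_prod (fun i _ => (Real.cosh_pos _).le)
            fun i _ => Real.cosh_le_exp_half_sq _
      _ = Real.exp (∑ i, (κ * ⟪x, v i⟫) ^ 2 / 2) := (Real.exp_sum _ _).symm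
      _ ≤ Real.exp (1 / 2) := by
          apply Real.exp_le_exp.2
          calc ∑ i, (κ * ⟪x, v i⟫) ^ 2 / 2
              ≤ ∑ _i : ι, κ ^ 2 * (10 * Fintype.card ι) / 2 :=
                Finset.sum_le_sum fun i _ => by gcongr; exact hc i
            _ = 5 * (κ * Fintype.card ι) ^ 2 := by simp; ring
            _ ≤ 5 * (1 / 10) ^ 2 := by gcongr
            _ ≤ 1 / 2 := by norm_num
      _ ≤ 2 := by
          have := Real.abs_exp_sub_one_sub_id_le (x := 1 / 2) (by norm_num [abs_of_pos])
          have := (abs_le.1 this).2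
          linarith

end Mixtures

/-! ### The `χ²` method for products of perturbed laws. -/

section ChiSquare

theorem ENNReal.tsum_pi_prod {Y : Type} : ∀ {n : ℕ} (f : Fin n → Y → ENNReal),
    ∑' y : Fin n → Y, ∏ i, f i (y i) = ∏ i, ∑' y, f i y := by
  intro n
  induction n with
  | zero => intro f; simp
  | succ n ih =>
    intro f
    rw [← (Fin.consEquiv fun _ : Fin (n + 1) => Y).tsum_eq, ENNReal.tsum_prod', Fin.prod_univ_succ,
      ← ih, ← ENNReal.tsum_mul_right]
    refine tsum_congr fun a => ?_
    rw [← ENNReal.tsum_mul_left]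
    refine tsum_congr fun b => ?_
    simp [Fin.prod_univ_succ, Fin.consEquiv]

variable {ι : Type} [Fintype ι] {Y : Type}

/-- A probability mass function `Q` and perturbations of it in the directions `D b`, of size at
most `α` relative to `Q`, such that all signed perturbations are nonnegative. -/
structure IsPerturbation (Q : Y → ℝ) (D : ι → Y → ℝ) (α : ℝ) : Prop where
  nonneg : ∀ y, 0 ≤ Q y
  hasSum : HasSum Q 1
  hasSum_dir : ∀ b, HasSum (D b) 0
  abs_le : ∀ b y, |D b y| ≤ α * Q y
  perturbed_nonneg : ∀ (z : ι → Bool) y, 0 ≤ Q y + ∑ b, boolSign (z b) * D b y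

/-- The matrix of `χ²` inner products of the perturbation directions. -/
noncomputable def chiMatrix (Q : Y → ℝ) (D : ι → Y → ℝ) : Matrix ι ι ℝ :=
  .of fun b b' => ∑' y, D b y * D b' y / Q y

namespace IsPerturbation

variable {Q : Y → ℝ} {D : ι → Y → ℝ} {α : ℝ}

theorem abs_mul_div_le (h : IsPerturbation Q D α) (b b' : ι) (y : Y) :
    |D b y * D b' y / Q y| ≤ α ^ 2 * Q y := by
  rcases (h.nonneg y).eq_or_lt with h0 | h0
  · simp [← h0]
  · rw [abs_div, abs_mul, abs_of_pos h0, div_le_iff₀ h0]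
    calc |D b y| * |D b' y| ≤ (α * Q y) * (α * Q y) :=
          mul_le_mul (h.abs_le b y) (h.abs_le b' y) (abs_nonneg _)
            ((abs_nonneg _).trans (h.abs_le b y))
      _ = α ^ 2 * Q y * Q y := by ring

theorem summable_mul_div (h : IsPerturbation Q D α) (b b' : ι) :
    Summable fun y => D b y * D b' y / Q y :=
  .of_norm_bounded (h.hasSum.summable.mul_left (α ^ 2)) (h.abs_mul_div_le b b')

theorem chiMatrix_diag_le (h : IsPerturbation Q D α) (b : ι) : chiMatrix Q D b b ≤ α ^ 2 := by
  have h1 : HasSum (fun y => α ^ 2 * Q y) (α ^ 2) := by simpa using h.hasSum.mul_left (α ^ 2)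
  exact hasSum_le (fun y => (le_abs_self _).trans (h.abs_mul_div_le b b y))
    (h.summable_mul_div b b).hasSum h1

theorem hasSum_chi (h : IsPerturbation Q D α) (c c' : ι → ℝ) :
    HasSum (fun y => (∑ b, c b * D b y) * (∑ b, c' b * D b y) / Q y)
      (∑ b, ∑ b', c b * c' b' * chiMatrix Q D b b') := by
  have : ∀ y, (∑ b, c b * D b y) * (∑ b, c' b * D b y) / Q y =
      ∑ b, ∑ b', c b * c' b' * (D b y * D b' y / Q y) := by
    intro y
    rw [Finset.sum_mul_sum, Finset.sum_div]
    refine Finset.sum_congr rfl fun b _ => ?_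
    rw [Finset.sum_div]
    exact Finset.sum_congr rfl fun b' _ => by ring
  simp only [this]
  exact hasSum_sum fun b _ => hasSum_sum fun b' _ => (h.summable_mul_div b b').hasSum.mul_left _

theorem chiMatrix_posSemidef (h : IsPerturbation Q D α) : (chiMatrix Q D).PosSemidef := by
  refine .of_dotProduct_mulVec_nonneg ?_ fun x => ?_
  · ext b b'
    simp [chiMatrix, mul_comm]
  · have hs := h.hasSum_chi x x
    have : star x ⬝ᵥ Matrix.mulVec (chiMatrix Q D) x =
        ∑ b, ∑ b', x b * x b' * chiMatrix Q D b b' := by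
      simp only [dotProduct, Matrix.mulVec, Finset.mul_sum, star_trivial]
      exact Finset.sum_congr rfl fun b _ => Finset.sum_congr rfl fun b' _ => by ring
    rw [this]
    exact hs.nonneg fun y => div_nonneg (mul_self_nonneg _) (h.nonneg y)

theorem eq_zero_of_eq_zero (h : IsPerturbation Q D α) {y : Y} (hy : Q y = 0) (b : ι) :
    D b y = 0 := by
  have := h.abs_le b y
  rw [hy, mul_zero] at this
  exact abs_eq_zero.1 (le_antisymm this (abs_nonneg _))

theorem hasSum_perturbed (h : IsPerturbation Q D α) (c : ι → ℝ) :
    HasSum (fun y => Q y + ∑ b, c b * D b y) 1 := by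
  simpa using h.hasSum.add
    (hasSum_sum fun b (_ : b ∈ Finset.univ) => (h.hasSum_dir b).mul_left (c b))

theorem hasSum_perturbed_mul (h : IsPerturbation Q D α) (c c' : ι → ℝ) :
    HasSum (fun y => (Q y + ∑ b, c b * D b y) * (Q y + ∑ b, c' b * D b y) / Q y)
      (1 + ∑ b, ∑ b', c b * c' b' * chiMatrix Q D b b') := by
  have h1 := ((h.hasSum_perturbed c).add (h.hasSum_perturbed c')).sub h.hasSum
  have h2 := h1.add (h.hasSum_chi c c')
  -- With `p`, `p'` the two perturbed laws, `p p' / Q = p + p' - Q + (p - Q)(p' - Q) / Q`. At zeros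
  -- of `Q` all terms vanish, because the directions are dominated by `Q`.
  have h3 : (fun y => (Q y + ∑ b, c b * D b y) * (Q y + ∑ b, c' b * D b y) / Q y) = fun y =>
      Q y + ∑ b, c b * D b y + (Q y + ∑ b, c' b * D b y) - Q y +
        (∑ b, c b * D b y) * (∑ b, c' b * D b y) / Q y := by
    funext y
    by_cases hy : Q y = 0
    · simp [hy, h.eq_zero_of_eq_zero hy]
    · field_simp
      ring
  rw [h3]
  simpa using h2

theorem tsum_ofReal_perturbed_mul_le (h : IsPerturbation Q D α) (z z' : ι → Bool) :
    ∑' y, ENNReal.ofReal ((Q y + ∑ b, boolSign (z b) * D b y) *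
        (Q y + ∑ b, boolSign (z' b) * D b y) / Q y) ≤
      ENNReal.ofReal (Real.exp
        (∑ b, ∑ b', boolSign (z b) * boolSign (z' b') * chiMatrix Q D b b')) := by
  have hs := h.hasSum_perturbed_mul (fun b => boolSign (z b)) fun b => boolSign (z' b)
  rw [← ENNReal.ofReal_tsum_of_nonneg (fun y => div_nonneg (mul_nonneg (h.perturbed_nonneg z y)
    (h.perturbed_nonneg z' y)) (h.nonneg y)) hs.summable, hs.tsum_eq]
  apply ENNReal.ofReal_le_ofReal
  rw [add_comm]
  exact Real.add_one_le_exp _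

end IsPerturbation

/-- The sum over the players of the matrices of `χ²` inner products. -/
noncomputable def totalChiMatrix {n : ℕ} (Q : Fin n → Y → ℝ) (D : Fin n → ι → Y → ℝ) :
    Matrix ι ι ℝ :=
  ∑ i, chiMatrix (Q i) (D i)

variable {n : ℕ} {Q : Fin n → Y → ℝ} {D : Fin n → ι → Y → ℝ} {α : ℝ}

theorem totalChiMatrix_posSemidef (h : ∀ i, IsPerturbation (Q i) (D i) α) :
    (totalChiMatrix Q D).PosSemidef :=
  Matrix.posSemidef_sum _ fun i _ => (h i).chiMatrix_posSemidef

theorem totalChiMatrix_diag_le (h : ∀ i, IsPerturbation (Q i) (D i) α) (b : ι) :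
    totalChiMatrix Q D b b ≤ n * α ^ 2 := by
  rw [totalChiMatrix, Matrix.sum_apply]
  calc ∑ i, chiMatrix (Q i) (D i) b b ≤ ∑ _i : Fin n, α ^ 2 :=
        Finset.sum_le_sum fun i _ => (h i).chiMatrix_diag_le b
    _ = n * α ^ 2 := by simp

/-- The joint probability of the messages `y` under the perturbation with signs `z`. -/
noncomputable def perturbedProb (Q : Fin n → Y → ℝ) (D : Fin n → ι → Y → ℝ) (z : ι → Bool)
    (y : Fin n → Y) : ℝ :=
  ∏ i, (Q i (y i) + ∑ b, boolSign (z b) * D i b (y i))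

theorem perturbedProb_nonneg (h : ∀ i, IsPerturbation (Q i) (D i) α) (z : ι → Bool)
    (y : Fin n → Y) : 0 ≤ perturbedProb Q D z y :=
  Finset.prod_nonneg fun i _ => (h i).perturbed_nonneg z (y i)

theorem tsum_ofReal_perturbedProb (h : ∀ i, IsPerturbation (Q i) (D i) α) (z : ι → Bool) :
    ∑' y, ENNReal.ofReal (perturbedProb Q D z y) = 1 := by
  simp only [perturbedProb]
  have : ∀ y : Fin n → Y, ENNReal.ofReal (∏ i, (Q i (y i) + ∑ b, boolSign (z b) * D i b (y i))) =
      ∏ i, ENNReal.ofReal (Q i (y i) + ∑ b, boolSign (z b) * D i b (y i)) :=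
    fun y => ENNReal.ofReal_prod_of_nonneg fun i _ => (h i).perturbed_nonneg z (y i)
  simp only [this]
  rw [ENNReal.tsum_pi_prod fun i y => ENNReal.ofReal (Q i y + ∑ b, boolSign (z b) * D i b y)]
  refine Finset.prod_eq_one fun i _ => ?_
  have hs := (h i).hasSum_perturbed fun b => boolSign (z b)
  rw [← ENNReal.ofReal_tsum_of_nonneg ((h i).perturbed_nonneg z) hs.summable, hs.tsum_eq,
    ENNReal.ofReal_one]

/-- The `χ²` inner product factors over the players. Bounding each factor by `1 + t ≤ exp t` turns
the product into the exponential of the summed matrix. -/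
theorem tsum_ofReal_perturbedProb_mul_le (h : ∀ i, IsPerturbation (Q i) (D i) α)
    (z z' : ι → Bool) :
    ∑' y, ENNReal.ofReal (perturbedProb Q D z y * perturbedProb Q D z' y / ∏ i, Q i (y i)) ≤
      ENNReal.ofReal (Real.exp
        (∑ b, ∑ b', boolSign (z b) * boolSign (z' b') * totalChiMatrix Q D b b')) := by
  have h1 : ∀ y : Fin n → Y, ENNReal.ofReal
      (perturbedProb Q D z y * perturbedProb Q D z' y / ∏ i, Q i (y i)) =
      ∏ i, ENNReal.ofReal ((Q i (y i) + ∑ b, boolSign (z b) * D i b (y i)) *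
        (Q i (y i) + ∑ b, boolSign (z' b) * D i b (y i)) / Q i (y i)) := by
    intro y
    rw [perturbedProb, perturbedProb, ← Finset.prod_mul_distrib, ← Finset.prod_div_distrib]
    exact ENNReal.ofReal_prod_of_nonneg fun i _ => div_nonneg (mul_nonneg
      ((h i).perturbed_nonneg z (y i)) ((h i).perturbed_nonneg z' (y i))) ((h i).nonneg (y i))
  simp only [h1]
  rw [ENNReal.tsum_pi_prod fun i y => ENNReal.ofReal ((Q i y + ∑ b, boolSign (z b) * D i b y) *
        (Q i y + ∑ b, boolSign (z' b) * D i b y) / Q i y)]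
  refine (Finset.prod_le_prod' fun i _ => (h i).tsum_ofReal_perturbed_mul_le z z').trans_eq ?_
  rw [← ENNReal.ofReal_prod_of_nonneg fun i _ => (Real.exp_pos _).le, ← Real.exp_sum]
  congr 2
  simp only [totalChiMatrix, Matrix.sum_apply, Finset.mul_sum]
  rw [Finset.sum_comm]
  refine Finset.sum_congr rfl fun b _ => ?_
  rw [Finset.sum_comm]

theorem tsum_ofReal_sq_div_le (h : ∀ i, IsPerturbation (Q i) (D i) α) {μ : (ι → Bool) → ℝ}
    (hμ : ∀ z, 0 ≤ μ z) (G : Finset (ι → Bool)) :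
    ∑' y, ENNReal.ofReal ((∑ z ∈ G, μ z * perturbedProb Q D z y) ^ 2 / ∏ i, Q i (y i)) ≤
      ENNReal.ofReal (∑ z ∈ G, ∑ z' ∈ G, μ z * μ z' * Real.exp
        (∑ b, ∑ b', boolSign (z b) * boolSign (z' b') * totalChiMatrix Q D b b')) := by
  have hQ : ∀ y : Fin n → Y, 0 ≤ ∏ i, Q i (y i) :=
    fun y => Finset.prod_nonneg fun i _ => (h i).nonneg _
  have h1 : ∀ y : Fin n → Y, ENNReal.ofReal
      ((∑ z ∈ G, μ z * perturbedProb Q D z y) ^ 2 / ∏ i, Q i (y i)) =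
      ∑ z ∈ G, ∑ z' ∈ G, ENNReal.ofReal (μ z * μ z') * ENNReal.ofReal
        (perturbedProb Q D z y * perturbedProb Q D z' y / ∏ i, Q i (y i)) := by
    intro y
    have hnn : ∀ z z', 0 ≤ μ z * μ z' *
        (perturbedProb Q D z y * perturbedProb Q D z' y / ∏ i, Q i (y i)) := fun z z' =>
      mul_nonneg (mul_nonneg (hμ z) (hμ z')) (div_nonneg (mul_nonneg
        (perturbedProb_nonneg h z y) (perturbedProb_nonneg h z' y)) (hQ y))
    have h2 : (∑ z ∈ G, μ z * perturbedProb Q D z y) ^ 2 / ∏ i, Q i (y i) =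
        ∑ z ∈ G, ∑ z' ∈ G, μ z * μ z' *
          (perturbedProb Q D z y * perturbedProb Q D z' y / ∏ i, Q i (y i)) := by
      rw [sq, Finset.sum_mul_sum, Finset.sum_div]
      refine Finset.sum_congr rfl fun z _ => ?_
      rw [Finset.sum_div]
      exact Finset.sum_congr rfl fun z' _ => by ring
    rw [h2, ENNReal.ofReal_sum_of_nonneg fun z _ => Finset.sum_nonneg fun z' _ => hnn z z']
    refine Finset.sum_congr rfl fun z _ => ?_
    rw [ENNReal.ofReal_sum_of_nonneg fun z' _ => hnn z z']
    exact Finset.sum_congr rfl fun z' _ => ENNReal.ofReal_mul (mul_nonneg (hμ z) (hμ z'))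
  simp only [h1]
  rw [Summable.tsum_finsetSum fun _ _ => ENNReal.summable,
    ENNReal.ofReal_sum_of_nonneg fun z _ => Finset.sum_nonneg fun z' _ =>
      mul_nonneg (mul_nonneg (hμ z) (hμ z')) (Real.exp_pos _).le]
  refine Finset.sum_le_sum fun z _ => ?_
  rw [Summable.tsum_finsetSum fun _ _ => ENNReal.summable,
    ENNReal.ofReal_sum_of_nonneg fun z' _ =>
      mul_nonneg (mul_nonneg (hμ z) (hμ z')) (Real.exp_pos _).le]
  refine Finset.sum_le_sum fun z' _ => ?_
  rw [ENNReal.tsum_mul_left, ENNReal.ofReal_mul (mul_nonneg (hμ z) (hμ z'))]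
  gcongr
  exact tsum_ofReal_perturbedProb_mul_le h z z'

variable [DecidableEq ι] in
/-- An event which is unlikely under the unperturbed law is not too likely under a spread mixture
of perturbations. -/
theorem mixture_le (h : ∀ i, IsPerturbation (Q i) (D i) α) {μ : (ι → Bool) → ℝ}
    (hμ : IsSpread μ (totalChiMatrix Q D)) {τ : (Fin n → Y) → ENNReal} (hτ : ∀ y, τ y ≤ 1) :
    ∑ z, ENNReal.ofReal (μ z) * ∑' y, ENNReal.ofReal (perturbedProb Q D z y) * τ y ≤
      ENNReal.ofReal (3 / 10) +
        ENNReal.ofReal (5 / 2) * ∑' y, ENNReal.ofReal (∏ i, Q i (y i)) * τ y := by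
  obtain ⟨hμ0, -, G, hG, hGG⟩ := hμ
  have hpt : ∀ y : Fin n → Y,
      ∑ z ∈ G, ENNReal.ofReal (μ z) * (ENNReal.ofReal (perturbedProb Q D z y) * τ y) ≤
        ENNReal.ofReal (1 / 10) * ENNReal.ofReal
          ((∑ z ∈ G, μ z * perturbedProb Q D z y) ^ 2 / ∏ i, Q i (y i)) +
        ENNReal.ofReal (5 / 2) * (ENNReal.ofReal (∏ i, Q i (y i)) * τ y) := by
    intro y
    set S := ∑ z ∈ G, μ z * perturbedProb Q D z y with hS
    set P := ∏ i, Q i (y i) with hP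
    have hP0 : 0 ≤ P := Finset.prod_nonneg fun i _ => (h i).nonneg _
    -- AM–GM splits the mixture density into a `χ²` part and a multiple of the null. The second
    -- moment `2` contributes `2/10`, and the mass outside `G` another `1/10`, hence `3/10`.
    have hSP : S ≤ 1 / 10 * (S ^ 2 / P) + 5 / 2 * P := by
      rcases hP0.eq_or_lt with h0 | h0
      · obtain ⟨i, -, hi⟩ := Finset.prod_eq_zero_iff.1 h0.symm
        have : S = 0 := by
          refine Finset.sum_eq_zero fun z _ => ?_
          rw [perturbedProb, Finset.prod_eq_zero (Finset.mem_univ i), mul_zero]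
          simp [hi, (h i).eq_zero_of_eq_zero hi]
        simp [this, ← h0]
      · have : 1 / 10 * (S ^ 2 / P) + 5 / 2 * P - S = (S - 5 * P) ^ 2 / (10 * P) := by
          field_simp
          ring
        have : 0 ≤ (S - 5 * P) ^ 2 / (10 * P) := by positivity
        linarith
    have hsum : ∑ z ∈ G, ENNReal.ofReal (μ z) * (ENNReal.ofReal (perturbedProb Q D z y) * τ y) =
        ENNReal.ofReal S * τ y := by
      rw [hS, ENNReal.ofReal_sum_of_nonneg fun z _ =>
        mul_nonneg (hμ0 z) (perturbedProb_nonneg h z y), Finset.sum_mul]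
      refine Finset.sum_congr rfl fun z _ => ?_
      rw [ENNReal.ofReal_mul (hμ0 z), mul_assoc]
    rw [hsum]
    calc ENNReal.ofReal S * τ y
        ≤ (ENNReal.ofReal (1 / 10) * ENNReal.ofReal (S ^ 2 / P) +
            ENNReal.ofReal (5 / 2) * ENNReal.ofReal P) * τ y := by
          gcongr
          rw [← ENNReal.ofReal_mul (by norm_num), ← ENNReal.ofReal_mul (by norm_num),
            ← ENNReal.ofReal_add (by positivity) (by positivity)]
          exact ENNReal.ofReal_le_ofReal hSP
      _ ≤ _ := by
          rw [add_mul, mul_assoc (ENNReal.ofReal (5 / 2))]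
          exact add_le_add (mul_le_of_le_one_right' (hτ y)) le_rfl
  rw [← Finset.sum_add_sum_compl G]
  have hout : ∑ z ∈ Gᶜ, ENNReal.ofReal (μ z) *
      ∑' y, ENNReal.ofReal (perturbedProb Q D z y) * τ y ≤ ENNReal.ofReal (1 / 10) := by
    calc _ ≤ ∑ z ∈ Gᶜ, ENNReal.ofReal (μ z) := by
          refine Finset.sum_le_sum fun z _ => mul_le_of_le_one_right' ?_
          rw [← tsum_ofReal_perturbedProb h z]
          exact ENNReal.tsum_le_tsum fun y => mul_le_of_le_one_right' (hτ y)
      _ = ENNReal.ofReal (∑ z ∈ Gᶜ, μ z) :=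
          (ENNReal.ofReal_sum_of_nonneg fun z _ => hμ0 z).symm
      _ ≤ _ := ENNReal.ofReal_le_ofReal hG
  have hin : ∑ z ∈ G, ENNReal.ofReal (μ z) *
      ∑' y, ENNReal.ofReal (perturbedProb Q D z y) * τ y ≤ ENNReal.ofReal (1 / 10 * 2) +
        ENNReal.ofReal (5 / 2) * ∑' y, ENNReal.ofReal (∏ i, Q i (y i)) * τ y := by
    simp only [← ENNReal.tsum_mul_left]
    rw [← Summable.tsum_finsetSum fun _ _ => ENNReal.summable]
    refine (ENNReal.tsum_le_tsum hpt).trans ?_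
    rw [ENNReal.tsum_add, ENNReal.tsum_mul_left, ENNReal.ofReal_mul (by norm_num)]
    gcongr
    exact (tsum_ofReal_sq_div_le h hμ0 G).trans (ENNReal.ofReal_le_ofReal hGG)
  calc _ ≤ _ := add_le_add hin hout
    _ = _ := by
      rw [add_right_comm, ← ENNReal.ofReal_add (by norm_num) (by norm_num)]
      norm_num

end ChiSquare

/-! ### Checkerboard perturbations and their distance to product laws. -/

section Blocks

variable {h : ℕ}

/-- The block distribution: a perturbation of the uniform distribution on `[2h] × [2h]`, in which
the `2 × 2` block `b` is perturbed by `c b` in a checkerboard pattern. -/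
noncomputable def blockWeight (c : Fin h × Fin h → ℝ) (x : (Fin h × Bool) × (Fin h × Bool)) : ℝ :=
  (1 + c (x.1.1, x.2.1) * boolSign x.1.2 * boolSign x.2.2) / (4 * (h : ℝ) ^ 2)

theorem sum_blocks (f : (Fin h × Bool) × (Fin h × Bool) → ℝ) :
    ∑ x, f x = ∑ b : Fin h × Fin h, ∑ r : Bool, ∑ s : Bool, f ((b.1, r), (b.2, s)) := by
  simp only [Fintype.sum_prod_type, Fintype.sum_bool]
  refine Finset.sum_congr rfl fun i _ => ?_
  simp only [← Finset.sum_add_distrib]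

theorem blockWeight_nonneg {c : Fin h × Fin h → ℝ} (hc : ∀ b, |c b| ≤ 1)
    (x : (Fin h × Bool) × (Fin h × Bool)) : 0 ≤ blockWeight c x := by
  have : |c (x.1.1, x.2.1) * boolSign x.1.2 * boolSign x.2.2| ≤ 1 := by
    rw [abs_mul, abs_mul, abs_boolSign, abs_boolSign, mul_one, mul_one]
    exact hc _
  have := (abs_le.1 this).1
  exact div_nonneg (by linarith) (by positivity)

theorem sum_blockWeight (hh : 0 < h) (c : Fin h × Fin h → ℝ) : ∑ x, blockWeight c x = 1 := by
  rw [sum_blocks]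
  have hh' : (0 : ℝ) < h := by exact_mod_cast hh
  have : ∀ b : Fin h × Fin h, ∑ r : Bool, ∑ s : Bool, blockWeight c ((b.1, r), (b.2, s)) =
      1 / (h : ℝ) ^ 2 := by
    intro b
    simp only [Fintype.sum_bool, blockWeight, boolSign]
    field_simp
    norm_num
    ring
  simp only [this]
  simp
  field_simp

/-- The embedding of `[h] × {0, 1}` into `[k]`. -/
def blockEmb {k : ℕ} (hk : 2 * h ≤ k) (x : Fin h × Bool) : Fin k :=
  ⟨2 * x.1 + x.2.toNat, by have := x.1.2; have := x.2.toNat_le; omega⟩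

theorem blockEmb_injective {k : ℕ} (hk : 2 * h ≤ k) : Function.Injective (blockEmb hk) := by
  rintro ⟨i, r⟩ ⟨j, s⟩ hij
  simp only [blockEmb, Fin.mk.injEq] at hij
  have hr := r.toNat_le
  have hs := s.toNat_le
  have h1 : (i : ℕ) = j := by omega
  have h2 : r.toNat = s.toNat := by omega
  rw [Prod.mk.injEq]
  refine ⟨Fin.ext h1, ?_⟩
  cases r <;> cases s <;> simp_all

/-- The block distribution on `[k] × [k]`. -/
noncomputable def blockPMF {k : ℕ} (hh : 0 < h) (hk : 2 * h ≤ k) (c : Fin h × Fin h → ℝ)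
    (hc : ∀ b, |c b| ≤ 1) : PMF (Fin k × Fin k) :=
  (PMF.ofFintype (fun x => ENNReal.ofReal (blockWeight c x)) (by
    rw [← ENNReal.ofReal_sum_of_nonneg fun x _ => blockWeight_nonneg hc x, sum_blockWeight hh,
      ENNReal.ofReal_one])).map (Prod.map (blockEmb hk) (blockEmb hk))

theorem PMF.sum_map_mul {A B : Type} [Fintype A] [Fintype B] (p : PMF A) (f : A → B)
    (g : B → ENNReal) : ∑ b, (p.map f) b * g b = ∑ a, p a * g (f a) := by
  classical
  simp only [PMF.map_apply, tsum_fintype, Finset.sum_mul, ite_mul, zero_mul]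
  rw [Finset.sum_comm]
  simp

theorem PMF.map_apply_of_injective {A B : Type} (p : PMF A) {f : A → B}
    (hf : Function.Injective f) (a : A) : (p.map f) (f a) = p a := by
  classical
  rw [PMF.map_apply, tsum_eq_single a]
  · simp
  · intro a' ha'
    rw [if_neg fun h => ha' (hf h).symm]

variable {k : ℕ} (hh : 0 < h) (hk : 2 * h ≤ k)

theorem sum_blockPMF_mul {c : Fin h × Fin h → ℝ} (hc : ∀ b, |c b| ≤ 1)
    (g : Fin k × Fin k → ENNReal) :
    ∑ x, blockPMF hh hk c hc x * g x =
      ∑ x, ENNReal.ofReal (blockWeight c x) * g (Prod.map (blockEmb hk) (blockEmb hk) x) := by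
  rw [blockPMF, PMF.sum_map_mul]
  simp only [PMF.ofFintype_apply]

theorem blockPMF_apply {c : Fin h × Fin h → ℝ} (hc : ∀ b, |c b| ≤ 1)
    (x : (Fin h × Bool) × (Fin h × Bool)) :
    blockPMF hh hk c hc (Prod.map (blockEmb hk) (blockEmb hk) x) =
      ENNReal.ofReal (blockWeight c x) := by
  rw [blockPMF, PMF.map_apply_of_injective _
    ((blockEmb_injective hk).prodMap (blockEmb_injective hk)), PMF.ofFintype_apply]

theorem map_fst_prodDist {A B : Type} (p : PMF A) (q : PMF B) :
    (prodDist p q).map Prod.fst = p := by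
  rw [prodDist, PMF.map_bind]
  simp only [PMF.map_comp]
  simp

theorem map_snd_prodDist {A B : Type} (p : PMF A) (q : PMF B) :
    (prodDist p q).map Prod.snd = q := by
  rw [prodDist, PMF.map_bind]
  simp only [PMF.map_comp]
  simpa using PMF.map_id q

theorem isIndependent_prodDist (p q : PMF (Fin k)) : IsIndependent (prodDist p q) := by
  rw [IsIndependent, map_fst_prodDist, map_snd_prodDist]

theorem isIndependent_blockPMF_zero :
    IsIndependent (blockPMF hh hk (fun _ => 0) (by simp)) := by
  have hh' : (0 : ℝ) < h := by exact_mod_cast hh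
  have hsum : ∑ _x : Fin h × Bool, ENNReal.ofReal (1 / (2 * h)) = 1 := by
    rw [← ENNReal.ofReal_sum_of_nonneg fun _ _ => by positivity]
    simp only [Finset.sum_const, Finset.card_univ, Fintype.card_prod, Fintype.card_fin,
      Fintype.card_bool, nsmul_eq_mul]
    push_cast
    rw [ENNReal.ofReal_eq_one]
    field_simp
  set m := PMF.ofFintype (fun _ : Fin h × Bool => ENNReal.ofReal (1 / (2 * h))) hsum with hm
  have : blockPMF hh hk (fun _ => 0) (by simp) =
      prodDist (m.map (blockEmb hk)) (m.map (blockEmb hk)) := by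
    have h1 : prodDist (m.map (blockEmb hk)) (m.map (blockEmb hk)) =
        (prodDist m m).map (Prod.map (blockEmb hk) (blockEmb hk)) := by
      simp only [prodDist, PMF.map_bind, PMF.bind_map, PMF.map_comp]
      rfl
    rw [h1, blockPMF]
    congr 1
    ext x
    rw [prodDist_apply, PMF.ofFintype_apply, hm, PMF.ofFintype_apply, PMF.ofFintype_apply,
      ← ENNReal.ofReal_mul (by positivity)]
    congr 1
    simp only [blockWeight]
    field_simp
    norm_num
  rw [this]
  exact isIndependent_prodDist _ _

/-- Since `a₁b₁ · a₂b₂ = a₁b₂ · a₂b₁`, the product matrix cannot vary strictly in the checkerboard's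
direction in both rows. In a row where it does not, the two errors already add up to at least
`2|w|`. -/
theorem two_mul_abs_le_of_rank_one (u w : ℝ) {a₁ a₂ b₁ b₂ : ℝ} (ha₁ : 0 ≤ a₁) (ha₂ : 0 ≤ a₂)
    (hb₁ : 0 ≤ b₁) (hb₂ : 0 ≤ b₂) :
    2 * |w| ≤ |u + w - a₁ * b₁| + |u - w - a₁ * b₂| + (|u - w - a₂ * b₁| + |u + w - a₂ * b₂|) := by
  have key : a₁ * b₁ * (a₂ * b₂) = a₁ * b₂ * (a₂ * b₁) := by ring
  have e₁ := abs_le.1 (le_refl |u + w - a₁ * b₁|)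
  have e₂ := abs_le.1 (le_refl |u - w - a₁ * b₂|)
  have e₃ := abs_le.1 (le_refl |u - w - a₂ * b₁|)
  have e₄ := abs_le.1 (le_refl |u + w - a₂ * b₂|)
  have n₁ := abs_nonneg (u + w - a₁ * b₁)
  have n₂ := abs_nonneg (u - w - a₁ * b₂)
  have n₃ := abs_nonneg (u - w - a₂ * b₁)
  have n₄ := abs_nonneg (u + w - a₂ * b₂)
  rcases le_total 0 w with hw | hw
  · rw [abs_of_nonneg hw]
    have : a₁ * b₁ ≤ a₁ * b₂ ∨ a₂ * b₂ ≤ a₂ * b₁ := by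
      by_contra hcon
      rw [not_or, not_le, not_le] at hcon
      exact (mul_lt_mul'' hcon.1 hcon.2 (by positivity) (by positivity)).ne' key
    rcases this with h | h <;> linarith
  · rw [abs_of_nonpos hw]
    have : a₁ * b₂ ≤ a₁ * b₁ ∨ a₂ * b₁ ≤ a₂ * b₂ := by
      by_contra hcon
      rw [not_or, not_le, not_le] at hcon
      exact (mul_lt_mul'' hcon.1 hcon.2 (by positivity) (by positivity)).ne key
    rcases this with h | h <;> linarith

/-- Each of the `h²` blocks contributes at least `2γ/(4h²)` to the `ℓ₁` distance, and total
variation halves the sum. Points outside the embedded square are discarded. -/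
theorem le_tvDist_blockPMF {c : Fin h × Fin h → ℝ} (hc : ∀ b, |c b| ≤ 1) {γ : ℝ}
    (hγ : ∀ b, |c b| = γ) (q₁ q₂ : PMF (Fin k)) :
    γ / 4 ≤ tvDist (blockPMF hh hk c hc) (prodDist q₁ q₂) := by
  have hh' : (0 : ℝ) < h := by exact_mod_cast hh
  set e := Prod.map (blockEmb hk) (blockEmb hk)
  have he : Function.Injective e := (blockEmb_injective hk).prodMap (blockEmb_injective hk)
  set f : Fin k × Fin k → ℝ := fun x =>
    |(blockPMF hh hk c hc x).toReal - (prodDist q₁ q₂ x).toReal| with hf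
  have h1 : ∑ x, f (e x) ≤ ∑ x, f x := by
    refine (Finset.sum_map Finset.univ ⟨e, he⟩ f).symm.trans_le ?_
    exact Finset.sum_le_sum_of_subset_of_nonneg (Finset.subset_univ _)
      fun x _ _ => abs_nonneg _
  have h2 : ∀ b : Fin h × Fin h, 2 * (γ / (4 * (h : ℝ) ^ 2)) ≤
      ∑ r : Bool, ∑ s : Bool, f (e ((b.1, r), (b.2, s))) := by
    intro b
    have := two_mul_abs_le_of_rank_one (1 / (4 * (h : ℝ) ^ 2)) (c b / (4 * (h : ℝ) ^ 2))
      (a₁ := (q₁ (blockEmb hk (b.1, true))).toReal) (a₂ := (q₁ (blockEmb hk (b.1, false))).toReal)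
      (b₁ := (q₂ (blockEmb hk (b.2, true))).toReal) (b₂ := (q₂ (blockEmb hk (b.2, false))).toReal)
      ENNReal.toReal_nonneg ENNReal.toReal_nonneg ENNReal.toReal_nonneg ENNReal.toReal_nonneg
    rw [abs_div, hγ, abs_of_pos (show 0 < 4 * (h : ℝ) ^ 2 by positivity)] at this
    have hfe : ∀ x, f (e x) = |blockWeight c x -
        (q₁ (blockEmb hk x.1)).toReal * (q₂ (blockEmb hk x.2)).toReal| := by
      intro x
      simp only [hf, e]
      rw [blockPMF_apply, prodDist_apply, ENNReal.toReal_mul,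
        ENNReal.toReal_ofReal (blockWeight_nonneg hc _)]
      rfl
    simp only [Fintype.sum_bool, hfe]
    refine this.trans_eq ?_
    simp only [blockWeight, boolSign]
    norm_num [add_div, sub_div, ← sub_eq_add_neg, neg_div]
  have h3 : γ / 2 ≤ ∑ x, f (e x) := by
    rw [sum_blocks fun x => f (e x)]
    calc γ / 2 = ∑ _b : Fin h × Fin h, 2 * (γ / (4 * (h : ℝ) ^ 2)) := by
          simp
          field_simp
          norm_num
      _ ≤ _ := Finset.sum_le_sum fun b _ => h2 b
  unfold tvDist
  linarith

theorem le_distToProducts_blockPMF {c : Fin h × Fin h → ℝ} (hc : ∀ b, |c b| ≤ 1) {γ : ℝ}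
    (hγ : ∀ b, |c b| = γ) : γ / 4 ≤ distToProducts (blockPMF hh hk c hc) := by
  have : Nonempty (Fin k) := ⟨⟨0, by omega⟩⟩
  have : Nonempty (PMF (Fin k)) := ⟨PMF.pure (Classical.arbitrary _)⟩
  exact le_ciInf fun q => le_tvDist_blockPMF hh hk hc hγ q.1 q.2

end Blocks

/-! ### Removing the samples and the private randomness. -/

section Channels

variable {X : Type} {n : ℕ}

/-- The probability of acceptance by `τ` of the messages sent through the channels `W` on i.i.d.
samples from `p`. -/
noncomputable def protocolProb [Fintype X] (W : Fin n → X → Message → ENNReal)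
    (τ : (Fin n → Message) → ENNReal) (p : PMF X) : ENNReal :=
  ∑' y : Fin n → Message, (∏ i, ∑ a, p a * W i a (y i)) * τ y

theorem sum_samples_eq_protocolProb [Fintype X] (W : Fin n → X → Message → ENNReal)
    (τ : (Fin n → Message) → ENNReal) (p : PMF X) :
    ∑ x : Fin n → X, (∏ i, p (x i)) * ∑' y : Fin n → Message, (∏ i, W i (x i) (y i)) * τ y =
      protocolProb W τ p := by
  classical
  simp only [protocolProb, ← ENNReal.tsum_mul_left]
  rw [← Summable.tsum_finsetSum fun _ _ => ENNReal.summable]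
  refine tsum_congr fun y => ?_
  simp only [← mul_assoc, ← Finset.prod_mul_distrib]
  rw [← Finset.sum_mul, Finset.prod_univ_sum, Fintype.piFinset_univ]

/-- A channel, given by its transition probabilities, satisfying the `ρ`-LDP constraint. -/
structure IsLDPKernel (ρ : ℝ) (W : X → Message → ENNReal) : Prop where
  tsum_eq_one : ∀ x, ∑' y, W x y = 1
  le_mul : ∀ x x' y, W x' y ≤ ENNReal.ofReal (Real.exp ρ) * W x y

theorem protocolProb_add [Fintype X] {W : Fin n → X → Message → ENNReal} (hW : ∀ i x, ∑' y, W i x y = 1)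
    {τ τ' : (Fin n → Message) → ENNReal} (hτ : ∀ y, τ y + τ' y = 1) (p : PMF X) :
    protocolProb W τ p + protocolProb W τ' p = 1 := by
  simp only [protocolProb]
  rw [← ENNReal.tsum_add]
  simp only [← mul_add, hτ, mul_one]
  rw [ENNReal.tsum_pi_prod fun i y => ∑ a, p a * W i a y]
  refine Finset.prod_eq_one fun i _ => ?_
  rw [Summable.tsum_finsetSum fun _ _ => ENNReal.summable]
  simp only [ENNReal.tsum_mul_left, hW, mul_one]
  rw [← tsum_fintype (L := .unconditional _)]
  exact p.tsum_coe

theorem lintegral_pi_prod {Ω : Fin n → Type u} [∀ i, MeasurableSpace (Ω i)]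
    (law : ∀ i, Measure (Ω i)) [∀ i, IsProbabilityMeasure (law i)] {f : ∀ i, Ω i → ENNReal}
    (hf : ∀ i, Measurable (f i)) :
    ∫⁻ s, ∏ i, f i (s i) ∂Measure.pi law = ∏ i, ∫⁻ s, f i s ∂law i := by
  refine (ProbabilityTheory.lintegral_prod_eq_prod_lintegral_of_indepFun Finset.univ
    (fun i (s : ∀ i, Ω i) => f i (s i))
    (ProbabilityTheory.iIndepFun_pi fun i => (hf i).aemeasurable)
    fun i => (hf i).comp (measurable_pi_apply i)).trans ?_
  exact Finset.prod_congr rfl fun i _ =>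
    (measurePreserving_eval law i).lintegral_comp (hf i)

variable {Ω : Fin n → Type u} [∀ i, MeasurableSpace (Ω i)] (law : ∀ i, Measure (Ω i))

/-- The channel of each player, averaged over the private randomness. -/
noncomputable def averagedChannel (W : ∀ i, Ω i → X → PMF Message) (i : Fin n) (x : X)
    (y : Message) : ENNReal :=
  ∫⁻ s, W i s x y ∂law i

variable [∀ i, IsProbabilityMeasure (law i)] {W : ∀ i, Ω i → X → PMF Message}

/-- For fixed samples the seeds are independent, so the expected product of transition probabilities
factors. A private-coin protocol thus acts as a deterministic choice of averaged channels. -/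
theorem lintegral_seeds (hW : ∀ i x y, Measurable fun s => W i s x y) (x : Fin n → X)
    (τ : (Fin n → Message) → ENNReal) :
    ∫⁻ s, ∑' y : Fin n → Message, (∏ i, W i (s i) (x i) (y i)) * τ y ∂Measure.pi law =
      ∑' y : Fin n → Message, (∏ i, averagedChannel law W i (x i) (y i)) * τ y := by
  have hm : ∀ y : Fin n → Message,
      Measurable fun s : ∀ i, Ω i => ∏ i, W i (s i) (x i) (y i) := fun y =>
    Finset.measurable_prod _ fun i _ => (hW i (x i) (y i)).comp (measurable_pi_apply i)
  rw [lintegral_tsum fun y => ((hm y).mul_const _).aemeasurable]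
  refine tsum_congr fun y => ?_
  rw [lintegral_mul_const _ (hm y), lintegral_pi_prod law fun i => hW i (x i) (y i)]
  rfl

theorem isLDPKernel_averagedChannel (hW : ∀ i x y, Measurable fun s => W i s x y) {ρ : ℝ}
    (hρ : ∀ i s, IsLDP ρ (W i s)) (i : Fin n) : IsLDPKernel ρ (averagedChannel law W i) where
  tsum_eq_one x := by
    simp only [averagedChannel]
    rw [← lintegral_tsum fun y => (hW i x y).aemeasurable]
    simp [PMF.tsum_coe]
  le_mul x x' y := by
    simp only [averagedChannel]
    rw [← lintegral_const_mul _ (hW i x y)]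
    exact lintegral_mono fun s => hρ i s x x' y

end Channels

/-! ### Local privacy bounds the effect of one block on a message. -/

section BlockChannels

variable {h k : ℕ}

/-- The law of a message under the uniform distribution on `[2h] × [2h]`. -/
noncomputable def blockBase (hk : 2 * h ≤ k) (W : Fin k × Fin k → Message → ENNReal)
    (y : Message) : ℝ :=
  ∑ x : (Fin h × Bool) × (Fin h × Bool),
    1 / (4 * (h : ℝ) ^ 2) * (W (Prod.map (blockEmb hk) (blockEmb hk) x) y).toReal

/-- The change in the law of a message due to a perturbation `γ` of the block `b`. -/
noncomputable def blockDir (hk : 2 * h ≤ k) (γ : ℝ) (W : Fin k × Fin k → Message → ENNReal)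
    (b : Fin h × Fin h) (y : Message) : ℝ :=
  γ / (4 * (h : ℝ) ^ 2) * ∑ r : Bool, ∑ s : Bool, boolSign r * boolSign s *
    (W (Prod.map (blockEmb hk) (blockEmb hk) ((b.1, r), (b.2, s))) y).toReal

variable (hk : 2 * h ≤ k) {W : Fin k × Fin k → Message → ENNReal} {ρ γ : ℝ}

theorem blockBase_add_sum_blockDir (c : Fin h × Fin h → ℝ) (y : Message) :
    blockBase hk W y + ∑ b, c b * blockDir hk γ W b y =
      ∑ x, blockWeight (fun b => γ * c b) x *
        (W (Prod.map (blockEmb hk) (blockEmb hk) x) y).toReal := by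
  rw [blockBase, sum_blocks, sum_blocks, ← Finset.sum_add_distrib]
  refine Finset.sum_congr rfl fun b _ => ?_
  simp only [blockDir, blockWeight, Fintype.sum_bool]
  ring

theorem IsLDPKernel.ne_top (hW : IsLDPKernel ρ W) (x : Fin k × Fin k) (y : Message) :
    W x y ≠ ⊤ :=
  ne_top_of_le_ne_top ENNReal.one_ne_top ((ENNReal.le_tsum y).trans_eq (hW.tsum_eq_one x))

theorem IsLDPKernel.toReal_le (hW : IsLDPKernel ρ W) (x x' : Fin k × Fin k) (y : Message) :
    (W x' y).toReal ≤ Real.exp ρ * (W x y).toReal := by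
  have := ENNReal.toReal_mono (ENNReal.mul_ne_top ENNReal.ofReal_ne_top (hW.ne_top x y))
    (hW.le_mul x x' y)
  rwa [ENNReal.toReal_mul, ENNReal.toReal_ofReal (Real.exp_pos _).le] at this

theorem IsLDPKernel.hasSum (hW : IsLDPKernel ρ W) (x : Fin k × Fin k) :
    HasSum (fun y => (W x y).toReal) 1 := by
  have h1 := hW.tsum_eq_one x
  have := ENNReal.hasSum_toReal (f := W x) (by rw [h1]; exact ENNReal.one_ne_top)
  rwa [← ENNReal.tsum_toReal_eq (hW.ne_top x), h1, ENNReal.toReal_one] at this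

theorem sum_blockPMF_mul_eq_ofReal (hh : 0 < h) (hW : IsLDPKernel ρ W) {c : Fin h × Fin h → ℝ}
    (hc : ∀ b, |c b| ≤ 1) (y : Message) :
    ∑ x, blockPMF hh hk c hc x * W x y = ENNReal.ofReal (∑ x, blockWeight c x *
      (W (Prod.map (blockEmb hk) (blockEmb hk) x) y).toReal) := by
  rw [sum_blockPMF_mul, ENNReal.ofReal_sum_of_nonneg fun x _ =>
    mul_nonneg (blockWeight_nonneg hc x) ENNReal.toReal_nonneg]
  refine Finset.sum_congr rfl fun x _ => ?_
  rw [ENNReal.ofReal_mul (blockWeight_nonneg hc x), ENNReal.ofReal_toReal (hW.ne_top _ _)]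

theorem abs_mul_boolSign_le (hγ : 0 ≤ γ) (hγ1 : γ ≤ 1) (z : Fin h × Fin h → Bool)
    (b : Fin h × Fin h) : |γ * boolSign (z b)| ≤ 1 := by
  rwa [abs_mul, abs_boolSign, mul_one, abs_of_nonneg hγ]

theorem sum_inv_blocks (hh : 0 < h) (t : ℝ) :
    ∑ _x : (Fin h × Bool) × (Fin h × Bool), 1 / (4 * (h : ℝ) ^ 2) * t = t := by
  have hh' : (0 : ℝ) < h := by exact_mod_cast hh
  simp only [Finset.sum_const, Finset.card_univ, Fintype.card_prod, Fintype.card_fin,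
    Fintype.card_bool, nsmul_eq_mul]
  push_cast
  field_simp
  norm_num

/-- The base law is an average of rows of `W`, each within a factor `e^ρ` of any other row. For `ρ ≤
1`, `e^ρ ≤ 1 + ρ + ρ² ≤ 1 + 2ρ`. -/
theorem IsLDPKernel.abs_sub_blockBase_le (hh : 0 < h) (hW : IsLDPKernel ρ W) (hρ : 0 < ρ) (hρ1 : ρ ≤ 1)
    (x : Fin k × Fin k) (y : Message) :
    (1 - ρ) * blockBase hk W y ≤ (W x y).toReal ∧
      (W x y).toReal ≤ (1 + 2 * ρ) * blockBase hk W y := by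
  have hh' : (0 : ℝ) < h := by exact_mod_cast hh
  have hexp : Real.exp ρ ≤ 1 + 2 * ρ := by
    have := (abs_le.1 (Real.abs_exp_sub_one_sub_id_le (x := ρ) (by rwa [abs_of_pos hρ]))).2
    nlinarith
  have hQ : 0 ≤ blockBase hk W y := Finset.sum_nonneg fun x _ => by positivity
  have h1 : (W x y).toReal ≤ Real.exp ρ * blockBase hk W y := by
    rw [← sum_inv_blocks hh (W x y).toReal, blockBase, Finset.mul_sum]
    refine Finset.sum_le_sum fun x' _ => ?_
    rw [mul_left_comm]
    gcongr
    exact hW.toReal_le _ _ y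
  have h2 : blockBase hk W y ≤ Real.exp ρ * (W x y).toReal := by
    rw [← sum_inv_blocks hh (Real.exp ρ * (W x y).toReal), blockBase]
    refine Finset.sum_le_sum fun x' _ => ?_
    gcongr
    exact hW.toReal_le _ _ y
  refine ⟨?_, h1.trans (by gcongr)⟩
  calc (1 - ρ) * blockBase hk W y ≤ Real.exp (-ρ) * (Real.exp ρ * (W x y).toReal) := by
        gcongr
        linarith [Real.add_one_le_exp (-ρ)]
    _ = (W x y).toReal := by rw [← mul_assoc, ← Real.exp_add]; simp

theorem IsLDPKernel.isPerturbation (hh : 0 < h) (hW : IsLDPKernel ρ W) (hρ : 0 < ρ) (hρ1 : ρ ≤ 1)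
    (hγ : 0 ≤ γ) (hγ1 : γ ≤ 1) :
    IsPerturbation (blockBase hk W) (blockDir hk γ W) (2 * γ * ρ / (h : ℝ) ^ 2) where
  nonneg y := Finset.sum_nonneg fun x _ => by positivity
  hasSum := by
    have := hasSum_sum (s := Finset.univ) fun (x : (Fin h × Bool) × (Fin h × Bool)) _ =>
      (hW.hasSum (Prod.map (blockEmb hk) (blockEmb hk) x)).mul_left (1 / (4 * (h : ℝ) ^ 2))
    rw [sum_inv_blocks hh] at this
    exact this
  hasSum_dir b := by
    have := (hasSum_sum (s := Finset.univ) fun (r : Bool) _ =>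
      hasSum_sum (s := Finset.univ) fun (s : Bool) _ =>
        (hW.hasSum (Prod.map (blockEmb hk) (blockEmb hk) ((b.1, r), (b.2, s)))).mul_left
          (boolSign r * boolSign s)).mul_left (γ / (4 * (h : ℝ) ^ 2))
    have h0 : γ / (4 * (h : ℝ) ^ 2) * ∑ r : Bool, ∑ s : Bool, boolSign r * boolSign s * 1 = 0 := by
      simp [boolSign]
    rw [h0] at this
    exact this
  abs_le b y := by
    have hh' : (0 : ℝ) < h := by exact_mod_cast hh
    have hQ : 0 ≤ blockBase hk W y := Finset.sum_nonneg fun x _ => by positivity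
    have hb := fun r s => hW.abs_sub_blockBase_le hk hh hρ hρ1
      (Prod.map (blockEmb hk) (blockEmb hk) ((b.1, r), (b.2, s))) y
    have key : |∑ r : Bool, ∑ s : Bool, boolSign r * boolSign s *
        (W (Prod.map (blockEmb hk) (blockEmb hk) ((b.1, r), (b.2, s))) y).toReal| ≤
        6 * ρ * blockBase hk W y := by
      -- Two entries enter with each sign, so the constant parts cancel and `2(1 + 2ρ) - 2(1 - ρ) =
      -- 6ρ` remains.
      have h₁ := hb true true
      have h₂ := hb true false
      have h₃ := hb false true
      have h₄ := hb false false
      simp only [Fintype.sum_bool, boolSign, if_true, Bool.false_eq_true, if_false]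
      rw [abs_le]
      constructor <;> linarith
    rw [blockDir, abs_mul, abs_of_nonneg (by positivity)]
    calc γ / (4 * (h : ℝ) ^ 2) * _ ≤ γ / (4 * (h : ℝ) ^ 2) * (6 * ρ * blockBase hk W y) := by
          gcongr
      _ = 3 / 4 * (2 * γ * ρ / (h : ℝ) ^ 2 * blockBase hk W y) := by ring
      _ ≤ 1 * (2 * γ * ρ / (h : ℝ) ^ 2 * blockBase hk W y) := by gcongr; norm_num
      _ = _ := one_mul _
  perturbed_nonneg z y := by
    rw [blockBase_add_sum_blockDir hk fun b => boolSign (z b)]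
    exact Finset.sum_nonneg fun x _ => mul_nonneg
      (blockWeight_nonneg (abs_mul_boolSign_le hγ hγ1 z) x) ENNReal.toReal_nonneg

/-- The total `χ²` matrix of the block perturbations. -/
noncomputable def blockChiMatrix {n : ℕ} (hk : 2 * h ≤ k) (γ : ℝ)
    (W : Fin n → Fin k × Fin k → Message → ENNReal) :
    Matrix (Fin h × Fin h) (Fin h × Fin h) ℝ :=
  totalChiMatrix (fun i => blockBase hk (W i)) fun i => blockDir hk γ (W i)

theorem block_mixture_le (hh : 0 < h) {n : ℕ} {W : Fin n → Fin k × Fin k → Message → ENNReal}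
    (hW : ∀ i, IsLDPKernel ρ (W i)) (hρ : 0 < ρ) (hρ1 : ρ ≤ 1) (hγ : 0 ≤ γ) (hγ1 : γ ≤ 1)
    {μ : (Fin h × Fin h → Bool) → ℝ} (hμ : IsSpread μ (blockChiMatrix hk γ W))
    {τ : (Fin n → Message) → ENNReal} (hτ : ∀ y, τ y ≤ 1) :
    ∑ z, ENNReal.ofReal (μ z) * protocolProb W τ
        (blockPMF hh hk (fun b => γ * boolSign (z b)) (abs_mul_boolSign_le hγ hγ1 z)) ≤
      ENNReal.ofReal (3 / 10) + ENNReal.ofReal (5 / 2) *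
        protocolProb W τ (blockPMF hh hk (fun _ => 0) (by simp)) := by
  have hP := fun i => (hW i).isPerturbation hk hh hρ hρ1 hγ hγ1
  have h1 : ∀ (z : Fin h × Fin h → Bool) (y : Fin n → Message),
      ∏ i, ∑ x, blockPMF hh hk (fun b => γ * boolSign (z b)) (abs_mul_boolSign_le hγ hγ1 z) x *
        W i x (y i) = ENNReal.ofReal (perturbedProb (fun i => blockBase hk (W i))
          (fun i => blockDir hk γ (W i)) z y) := by
    intro z y
    rw [perturbedProb, ENNReal.ofReal_prod_of_nonneg fun i _ => (hP i).perturbed_nonneg z (y i)]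
    refine Finset.prod_congr rfl fun i _ => ?_
    rw [sum_blockPMF_mul_eq_ofReal hk hh (hW i),
      blockBase_add_sum_blockDir hk fun b => boolSign (z b)]
  have h0 : ∀ y : Fin n → Message,
      ∏ i, ∑ x, blockPMF hh hk (fun _ => 0) (by simp) x * W i x (y i) =
        ENNReal.ofReal (∏ i, blockBase hk (W i) (y i)) := by
    intro y
    rw [ENNReal.ofReal_prod_of_nonneg fun i _ => (hP i).nonneg (y i)]
    refine Finset.prod_congr rfl fun i _ => ?_
    rw [sum_blockPMF_mul_eq_ofReal hk hh (hW i)]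
    congr 1
    simp [blockBase, blockWeight]
  simp only [protocolProb, h1, h0]
  exact mixture_le hP hμ hτ

theorem blockChiMatrix_posSemidef {n : ℕ} {W : Fin n → Fin k × Fin k → Message → ENNReal}
    (hh : 0 < h) (hW : ∀ i, IsLDPKernel ρ (W i)) (hρ : 0 < ρ) (hρ1 : ρ ≤ 1) (hγ : 0 ≤ γ)
    (hγ1 : γ ≤ 1) : (blockChiMatrix hk γ W).PosSemidef :=
  totalChiMatrix_posSemidef fun i => (hW i).isPerturbation hk hh hρ hρ1 hγ hγ1

theorem blockChiMatrix_diag_le {n : ℕ} {W : Fin n → Fin k × Fin k → Message → ENNReal}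
    (hh : 0 < h) (hW : ∀ i, IsLDPKernel ρ (W i)) (hρ : 0 < ρ) (hρ1 : ρ ≤ 1) (hγ : 0 ≤ γ)
    (hγ1 : γ ≤ 1) (b : Fin h × Fin h) :
    blockChiMatrix hk γ W b b ≤ n * (2 * γ * ρ / (h : ℝ) ^ 2) ^ 2 :=
  totalChiMatrix_diag_le (fun i => (hW i).isPerturbation hk hh hρ hρ1 hγ hγ1) b

end BlockChannels

/-! ### From the mixture bound to the number of players. -/

section Reduction

/-- A null rejection probability of at most `1/12` caps the mixture's at `3/10 + 5/24`, which is
below the required `11/12`. -/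
theorem not_solves_of_mixture_le {X α : Type} [Fintype α] {P : PMF X → Bool → ENNReal}
    {μ : α → ℝ} (hμ : ∀ z, 0 ≤ μ z) (hμ1 : ∑ z, μ z = 1) {p₀ : PMF X} {p : α → PMF X}
    (hone : P p₀ true + P p₀ false = 1)
    (hmix : ∑ z, ENNReal.ofReal (μ z) * P (p z) false ≤
      ENNReal.ofReal (3 / 10) + ENNReal.ofReal (5 / 2) * P p₀ false)
    (h₀ : ENNReal.ofReal (1 - 1 / 12) < P p₀ true)
    (h₁ : ∀ z, ENNReal.ofReal (1 - 1 / 12) < P (p z) false) : False := by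
  have ht : P p₀ true ≠ ⊤ := ne_top_of_le_ne_top ENNReal.one_ne_top (hone ▸ le_self_add)
  have hf : P p₀ false ≠ ⊤ := ne_top_of_le_ne_top ENNReal.one_ne_top (hone ▸ le_add_self)
  have h2 : (P p₀ true).toReal + (P p₀ false).toReal = 1 := by
    rw [← ENNReal.toReal_add ht hf, hone, ENNReal.toReal_one]
  have h3 : (1 - 1 / 12 : ℝ) ≤ (P p₀ true).toReal := (ENNReal.ofReal_le_iff_le_toReal ht).1 h₀.le
  have h4 : P p₀ false ≤ ENNReal.ofReal (1 / 12) := by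
    rw [ENNReal.le_ofReal_iff_toReal_le hf (by norm_num)]
    linarith
  have h5 : ENNReal.ofReal (1 - 1 / 12) ≤ ∑ z, ENNReal.ofReal (μ z) * P (p z) false := by
    calc ENNReal.ofReal (1 - 1 / 12)
        = ∑ z, ENNReal.ofReal (μ z) * ENNReal.ofReal (1 - 1 / 12) := by
          rw [← Finset.sum_mul, ← ENNReal.ofReal_sum_of_nonneg fun z _ => hμ z, hμ1,
            ENNReal.ofReal_one, one_mul]
      _ ≤ _ := Finset.sum_le_sum fun z _ => by gcongr; exact (h₁ z).le
  have h6 : ENNReal.ofReal (1 - 1 / 12) ≤ ENNReal.ofReal (3 / 10 + 5 / 2 * (1 / 12)) := by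
    rw [ENNReal.ofReal_add (by norm_num) (by norm_num), ENNReal.ofReal_mul (by norm_num)]
    exact (h5.trans hmix).trans (by gcongr)
  rw [ENNReal.ofReal_le_ofReal_iff (by norm_num)] at h6
  norm_num at h6

variable {k n : ℕ} {ε ρ : ℝ}

theorem PMF.true_add_false (p : PMF Bool) : p true + p false = 1 := by
  rw [← p.tsum_coe, tsum_bool, add_comm]

/-- The size `γ = 5ε` makes the distance bound `γ/4` strictly exceed `ε`, and `5ε ≤ 1` keeps the
weights nonnegative. -/
theorem not_solves_of_block_mixture {h : ℕ} (hh : 0 < h) (hk : 2 * h ≤ k) (hε : 0 < ε)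
    (hγ : 0 ≤ 5 * ε) (hγ1 : 5 * ε ≤ 1) {P : PMF (Fin k × Fin k) → Bool → ENNReal}
    {μ : (Fin h × Fin h → Bool) → ℝ} (hμ : ∀ z, 0 ≤ μ z) (hμ1 : ∑ z, μ z = 1)
    (hone : ∀ p, P p true + P p false = 1)
    (hmix : ∑ z, ENNReal.ofReal (μ z) * P (blockPMF hh hk (fun b => 5 * ε * boolSign (z b))
        (abs_mul_boolSign_le hγ hγ1 z)) false ≤
      ENNReal.ofReal (3 / 10) + ENNReal.ofReal (5 / 2) *
        P (blockPMF hh hk (fun _ => 0) (by simp)) false)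
    (hsolve : SolvesIndependenceTesting k ε (1 / 12) P) : False := by
  refine not_solves_of_mixture_le hμ hμ1 (hone _) hmix
    ((hsolve _).1 (isIndependent_blockPMF_zero hh hk)) fun z => (hsolve _).2 ?_
  refine lt_of_lt_of_le ?_ (le_distToProducts_blockPMF hh hk (abs_mul_boolSign_le hγ hγ1 z)
    (γ := 5 * ε) fun b => ?_)
  · linarith
  · rw [abs_mul, abs_boolSign, mul_one, abs_of_nonneg hγ]

namespace PrivateCoinProtocol

variable (π : PrivateCoinProtocol.{u} (Fin k × Fin k) ρ n)

theorem outputProb_eq (T : (Fin n → Message) → PMF Bool) (p : PMF (Fin k × Fin k)) (b : Bool) :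
    π.outputProb T p b =
      protocolProb (averagedChannel π.seedLaw π.channel) (fun y => T y b) p := by
  rw [outputProb, ← sum_samples_eq_protocolProb]
  refine Finset.sum_congr rfl fun x _ => ?_
  rw [lintegral_seeds π.seedLaw π.measurable_channel x fun y => T y b]

theorem lower_bound (hk2 : 2 ≤ k) (hε : 0 < ε) (hε6 : ε ≤ 1 / 6) (hρ : 0 < ρ) (hρ1 : ρ ≤ 1)
    (T : (Fin n → Message) → PMF Bool)
    (hsolve : SolvesIndependenceTesting k ε (1 / 12) (π.outputProb T)) :
    1 / 10 ^ 8 * ((k : ℝ) ^ 3 / (ε ^ 2 * ρ ^ 2)) ≤ n := by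
  by_contra! hn
  obtain ⟨h, hh, hk, hk3⟩ : ∃ h, 0 < h ∧ 2 * h ≤ k ∧ k ≤ 3 * h := ⟨k / 2, by omega⟩
  have hh' : (0 : ℝ) < h := by exact_mod_cast hh
  have hk3' : (k : ℝ) ≤ 3 * h := by exact_mod_cast hk3
  have : Nonempty (Fin h × Fin h) := ⟨(⟨0, hh⟩, ⟨0, hh⟩)⟩
  have hγ : 0 ≤ 5 * ε := by positivity
  have hγ1 : 5 * ε ≤ 1 := by linarith
  have hW := isLDPKernel_averagedChannel π.seedLaw π.measurable_channel π.isLDP_channel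
  have hcube : (k : ℝ) ^ 3 ≤ 27 * (h : ℝ) ^ 3 := by
    calc (k : ℝ) ^ 3 ≤ (3 * h) ^ 3 := by gcongr
      _ = _ := by ring
  -- With `m = h²` blocks, `κ = 1/(20000 h)` gives `κ² m = 1/20000²` exactly. From `k ≤ 3h`, the
  -- left side is at most `100 · 27 · 10⁻⁸ / h`.
  have hn' : (n : ℝ) * (2 * (5 * ε) * ρ / (h : ℝ) ^ 2) ^ 2 ≤ 1 / (20000 * h) := by
    rw [mul_div_assoc', lt_div_iff₀ (by positivity)] at hn
    have : (n : ℝ) * (2 * (5 * ε) * ρ / (h : ℝ) ^ 2) ^ 2 =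
        100 * (n * (ε ^ 2 * ρ ^ 2)) / (h : ℝ) ^ 4 := by
      field_simp
      ring
    rw [this, div_le_div_iff₀ (by positivity) (by positivity)]
    nlinarith
  obtain ⟨μ, hμ⟩ := exists_isSpread
    (blockChiMatrix_posSemidef hk hh hW hρ hρ1 hγ hγ1) (κ := 1 / (20000 * h)) (by positivity)
    (fun b => (blockChiMatrix_diag_le hk hh hW hρ hρ1 hγ hγ1 b).trans hn') (by
      simp only [Fintype.card_prod, Fintype.card_fin]
      push_cast
      refine le_of_eq ?_
      field_simp)
  refine not_solves_of_block_mixture hh hk hε hγ hγ1 hμ.1 hμ.2.1 (fun p => ?_) ?_ hsolve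
  · simp only [outputProb_eq]
    exact protocolProb_add (fun i => (hW i).tsum_eq_one) (fun y => (T y).true_add_false) p
  · simp only [outputProb_eq]
    exact block_mixture_le hk hh hW hρ hρ1 hγ hγ1 hμ fun y => (T y).coe_le_one false

end PrivateCoinProtocol

namespace PublicCoinProtocol

variable (π : PublicCoinProtocol.{u} (Fin k × Fin k) ρ n)

/-- The averaged channels of the players when the public seed is `r`. -/
noncomputable def publicChannel (r : π.PublicSeed) :
    Fin n → Fin k × Fin k → Message → ENNReal :=
  averagedChannel π.seedLaw fun i => π.channel i r

theorem measurable_publicChannel (i : Fin n) (x : Fin k × Fin k) (y : Message) :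
    Measurable fun r => π.publicChannel r i x y :=
  (π.measurable_channel i x y).lintegral_prod_right'

theorem measurable_channel_right (r : π.PublicSeed) (i : Fin n) (x : Fin k × Fin k)
    (y : Message) : Measurable fun s => π.channel i r s x y :=
  (π.measurable_channel i x y).comp measurable_prodMk_left

theorem isLDPKernel_publicChannel (r : π.PublicSeed) (i : Fin n) :
    IsLDPKernel ρ (π.publicChannel r i) :=
  isLDPKernel_averagedChannel π.seedLaw (π.measurable_channel_right r)
    (fun i => π.isLDP_channel i r) i

variable (T : π.Referee)

theorem measurable_protocolProb (p : PMF (Fin k × Fin k)) (b : Bool) :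
    Measurable fun r => protocolProb (π.publicChannel r) (fun y => T.decide r y b) p := by
  refine Measurable.tsum fun y => Measurable.mul ?_ (T.measurable_decide y b)
  exact Finset.measurable_prod _ fun i _ => Finset.measurable_sum _ fun a _ =>
    (π.measurable_publicChannel i a (y i)).const_mul _

theorem outputProb_eq (p : PMF (Fin k × Fin k)) (b : Bool) :
    π.outputProb T p b = ∫⁻ r, protocolProb (π.publicChannel r) (fun y => T.decide r y b) p
      ∂π.publicLaw := by
  simp only [outputProb, ← sum_samples_eq_protocolProb]
  have hm : ∀ x : Fin n → Fin k × Fin k, Measurable fun r => ∑' y : Fin n → Message,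
      (∏ i, π.publicChannel r i (x i) (y i)) * T.decide r y b := fun x =>
    Measurable.tsum fun y => (Finset.measurable_prod _ fun i _ =>
      π.measurable_publicChannel i (x i) (y i)).mul (T.measurable_decide y b)
  rw [lintegral_finsetSum _ fun x _ => (hm x).const_mul _]
  refine Finset.sum_congr rfl fun x _ => ?_
  rw [lintegral_const_mul _ (hm x)]
  congr 1
  refine lintegral_congr fun r => ?_
  exact lintegral_seeds π.seedLaw (π.measurable_channel_right r) x fun y => T.decide r y b

theorem lower_bound (hk2 : 2 ≤ k) (hε : 0 < ε) (hε6 : ε ≤ 1 / 6) (hρ : 0 < ρ) (hρ1 : ρ ≤ 1)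
    (hsolve : SolvesIndependenceTesting k ε (1 / 12) (π.outputProb T)) :
    1 / 10 ^ 8 * ((k : ℝ) ^ 2 / (ε ^ 2 * ρ ^ 2)) ≤ n := by
  by_contra! hn
  obtain ⟨h, hh, hk, hk3⟩ : ∃ h, 0 < h ∧ 2 * h ≤ k ∧ k ≤ 3 * h := ⟨k / 2, by omega⟩
  have hh' : (0 : ℝ) < h := by exact_mod_cast hh
  have hk3' : (k : ℝ) ≤ 3 * h := by exact_mod_cast hk3
  have : Nonempty (Fin h × Fin h) := ⟨(⟨0, hh⟩, ⟨0, hh⟩)⟩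
  have hγ : 0 ≤ 5 * ε := by positivity
  have hγ1 : 5 * ε ≤ 1 := by linarith
  have hsq : (k : ℝ) ^ 2 ≤ 9 * (h : ℝ) ^ 2 := by
    calc (k : ℝ) ^ 2 ≤ (3 * h) ^ 2 := by gcongr
      _ = _ := by ring
  have hn' : (n : ℝ) * (2 * (5 * ε) * ρ / (h : ℝ) ^ 2) ^ 2 ≤ 1 / (10 * (h : ℝ) ^ 2) := by
    rw [mul_div_assoc', lt_div_iff₀ (by positivity)] at hn
    have : (n : ℝ) * (2 * (5 * ε) * ρ / (h : ℝ) ^ 2) ^ 2 =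
        100 * (n * (ε ^ 2 * ρ ^ 2)) / (h : ℝ) ^ 4 := by
      field_simp
      ring
    rw [this, div_le_div_iff₀ (by positivity) (by positivity)]
    have : (0 : ℝ) < (h : ℝ) ^ 2 := by positivity
    nlinarith
  -- The same uniform prior is spread for every public seed `r`, so the mixture bound can be
  -- integrated over `r`. A prior adapted to the channels would depend on `r`.
  have hμ : ∀ r, IsSpread (fun _ => ((2 : ℝ) ^ Fintype.card (Fin h × Fin h))⁻¹)
      (blockChiMatrix hk (5 * ε) (π.publicChannel r)) := fun r =>
    isSpread_uniform
      (blockChiMatrix_posSemidef hk hh (π.isLDPKernel_publicChannel r) hρ hρ1 hγ hγ1)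
      (κ := 1 / (10 * (h : ℝ) ^ 2)) (by positivity)
      (fun b => (blockChiMatrix_diag_le hk hh (π.isLDPKernel_publicChannel r)
        hρ hρ1 hγ hγ1 b).trans hn') (by
      simp only [Fintype.card_prod, Fintype.card_fin]
      push_cast
      refine le_of_eq ?_
      field_simp)
  have : Nonempty π.PublicSeed := π.publicLaw.nonempty_of_neZero
  obtain ⟨hμ0, hμ1, -⟩ := hμ (Classical.arbitrary _)
  refine not_solves_of_block_mixture hh hk hε hγ hγ1 hμ0 hμ1 (fun p => ?_) ?_ hsolve
  · simp only [outputProb_eq]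
    rw [← lintegral_add_left (π.measurable_protocolProb T p true)]
    have : ∀ r, protocolProb (π.publicChannel r) (fun y => T.decide r y true) p +
        protocolProb (π.publicChannel r) (fun y => T.decide r y false) p = 1 := fun r =>
      protocolProb_add (fun i => (π.isLDPKernel_publicChannel r i).tsum_eq_one)
        (fun y => (T.decide r y).true_add_false) p
    simp [this]
  · simp only [outputProb_eq]
    refine (Finset.sum_congr rfl fun z _ => (lintegral_const_mul _
      (π.measurable_protocolProb T _ false)).symm).trans_le ?_
    rw [← lintegral_finsetSum _ fun z _ =>
        (π.measurable_protocolProb T _ false).const_mul _,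
      ← lintegral_const_mul _ (π.measurable_protocolProb T _ false)]
    have hc : ENNReal.ofReal (3 / 10) = ∫⁻ _, ENNReal.ofReal (3 / 10) ∂π.publicLaw := by simp
    rw [hc, ← lintegral_add_left measurable_const]
    exact lintegral_mono fun r => block_mixture_le hk hh (π.isLDPKernel_publicChannel r)
      hρ hρ1 hγ hγ1 (hμ r) fun y => (T.decide r y).coe_le_one false

end PublicCoinProtocol

end Reduction

/-- Lower bounds on the number of players in private-coin and public-coin `ρ`-LDP protocols for
independence testing over `[k] × [k]`. -/
theorem mainTheorem6 :
    ∃ c : ℝ, 0 < c ∧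
      ∀ (k n : ℕ) (ε ρ : ℝ), 2 ≤ k → 0 < ε → ε ≤ 1 / 6 → 0 < ρ → ρ ≤ 1 →
        (∀ (π : PrivateCoinProtocol.{u} (Fin k × Fin k) ρ n) (T : (Fin n → Message) → PMF Bool),
          SolvesIndependenceTesting k ε (1 / 12) (π.outputProb T) →
            c * ((k : ℝ) ^ 3 / (ε ^ 2 * ρ ^ 2)) ≤ n) ∧
        (∀ (π : PublicCoinProtocol.{u} (Fin k × Fin k) ρ n) (T : π.Referee),
          SolvesIndependenceTesting k ε (1 / 12) (π.outputProb T) →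
            c * ((k : ℝ) ^ 2 / (ε ^ 2 * ρ ^ 2)) ≤ n) := by

  refine ⟨1 / 10 ^ 8, by norm_num, fun k n ε ρ hk hε hε6 hρ hρ1 =>
    ⟨fun π T hs => ?_, fun π T hs => ?_⟩⟩
  · exact π.lower_bound hk hε hε6 hρ hρ1 T hs
  · exact π.lower_bound T hk hε hε6 hρ hρ1 hs
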